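/- Let $n\ge 1$ be an integer, let $\mathbb S^{2n+1}=\{\zeta\in\mathbb C^{n+1}:\sum_{i}|\zeta_i|^2=1\}$ carry its (non-normalized) surface measure $d\eta$, and write $\zeta\cdot\overline\eta=\sum_{i=1}^{n+1}\zeta_i\overline{\eta_i}$. For integers $j,k\ge 0$ let $\mathcal H_{j,k}$ be the space of restrictions to $\mathbb S^{2n+1}$ of harmonic polynomials $p(z,\overline z)$ on $\mathbb C^{n+1}$ that are homogeneous of degree $j$ in $z$ and homogeneous of degree $k$ in $\overline z$. We say that $\lambda$ is the eigenvalue on $\mathcal H_{j,k}$ of the integral operator with kernel $K(\zeta,\eta)$ if $\mathcal H_{j,k}\neq\{0\}$ and, for every $Y\in\mathcal H_{j,k}$ and every $\zeta\in\mathbb S^{2n+1}$, the integral $\int_{\mathbb S^{2n+1}}K(\zeta,\eta)Y(\eta)\,d\eta$ converges absolutely and equals $\lambda Y(\zeta)$. Let $-1<\alpha<(n+1)/2$ and let $j,k\ge 0$ be integers. (1) The eigenvalue of the operator with kernel $|1-\zeta\cdot\overline\eta|^{-2\alpha}$ on $\mathcal H_{j,k}$ is $$E_{j,k}:=\frac{2\pi^{n+1}\,\Gamma(n+1-2\alpha)}{\Gamma(\alpha)^2}\,\frac{\Gamma(j+\alpha)}{\Gamma(j+n+1-\alpha)}\,\frac{\Gamma(k+\alpha)}{\Gamma(k+n+1-\alpha)}.$$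 (2) The eigenvalue of the operator with kernel $|\zeta\cdot\overline\eta|^2\,|1-\zeta\cdot\overline\eta|^{-2\alpha}$ on $\mathcal H_{j,k}$ is $$E_{j,k}\left(1-\frac{(\alpha-1)(n+1-2\alpha)\bigl(2jk+n(j+k-1+\alpha)\bigr)}{(j-1+\alpha)(j+n+1-\alpha)(k-1+\alpha)(k+n+1-\alpha)}\right).$$ When $\alpha=0$ or $\alpha=1$, these two expressions are to be understood as their limits (which exist and are finite) as the real parameter tends to $\alpha$ with $n,j,k$ fixed. -/

import Mathlib

open Filter Topology MeasureTheory ComplexConjugate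

noncomputable section

namespace ComplexSphere

/-- The unit sphere `S^{2n+1}` in `ℂ^{n+1}` (with the Euclidean norm). -/
abbrev Sph (n : ℕ) : Type := Metric.sphere (0 : EuclideanSpace ℂ (Fin (n + 1))) 1

/-- The standard (non-normalized) surface measure on `S^{2n+1}`. -/
def surface (n : ℕ) : Measure (Sph n) :=
  (volume : Measure (EuclideanSpace ℂ (Fin (n + 1)))).toSphere

/-- `ζ · η̄ = ∑ ζᵢ η̄ᵢ`. -/
def dotConj {n : ℕ} (ζ η : Sph n) : ℂ :=
  ∑ i, (ζ : EuclideanSpace ℂ (Fin (n + 1))) i * conj ((η : EuclideanSpace ℂ (Fin (n + 1))) i)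

/-- Polynomials `p(z, z̄)`: the variable `Sum.inl i` stands for `zᵢ`, and `Sum.inr i` for `z̄ᵢ`. -/
abbrev BiPoly (n : ℕ) : Type := MvPolynomial (Fin (n + 1) ⊕ Fin (n + 1)) ℂ

/-- `∑ᵢ ∂²/∂zᵢ∂z̄ᵢ`, which is one quarter of the Laplacian of `ℂ^{n+1} = ℝ^{2n+2}`. -/
def quarterLaplacian (n : ℕ) : BiPoly n →ₗ[ℂ] BiPoly n :=
  ∑ i, (MvPolynomial.pderiv (R := ℂ) (Sum.inl i : Fin (n + 1) ⊕ Fin (n + 1))).toLinearMap ∘ₗ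
    (MvPolynomial.pderiv (R := ℂ) (Sum.inr i : Fin (n + 1) ⊕ Fin (n + 1))).toLinearMap

/-- Harmonic polynomials, homogeneous of degree `j` in `z` and of degree `k` in `z̄`. -/
def harmonicPoly (n j k : ℕ) : Submodule ℂ (BiPoly n) :=
  MvPolynomial.weightedHomogeneousSubmodule ℂ (Sum.elim (fun _ => 1) (fun _ => 0)) j ⊓
  MvPolynomial.weightedHomogeneousSubmodule ℂ (Sum.elim (fun _ => 0) (fun _ => 1)) k ⊓
  LinearMap.ker (quarterLaplacian n)

/-- The function `ζ ↦ p(ζ, ζ̄)` on the sphere. -/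
def restrict (n : ℕ) : BiPoly n →ₗ[ℂ] (Sph n → ℂ) :=
  LinearMap.pi fun ζ => (MvPolynomial.aeval (Sum.elim
    (fun i => (ζ : EuclideanSpace ℂ (Fin (n + 1))) i)
    (fun i => conj ((ζ : EuclideanSpace ℂ (Fin (n + 1))) i)))).toLinearMap

/-- The space `𝓗_{j,k}` of functions on `S^{2n+1}`. -/
def Hjk (n j k : ℕ) : Submodule ℂ (Sph n → ℂ) := (harmonicPoly n j k).map (restrict n)

/-- The integral operator with kernel `K(ζ, η)` acts on the space `V` as multiplication by `c`:
`V ≠ 0`, and for every `Y ∈ V` and every `ζ` the integral `∫ K(ζ, η) Y(η) dη` converges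
absolutely and equals `c Y(ζ)`. -/
def ActsAs {n : ℕ} (K : Sph n → Sph n → ℝ) (V : Submodule ℂ (Sph n → ℂ)) (c : ℝ) : Prop :=
  V ≠ ⊥ ∧ ∀ Y ∈ V, ∀ ζ : Sph n,
    Integrable (fun η => (K ζ η : ℂ) * Y η) (surface n) ∧
    ∫ η, (K ζ η : ℂ) * Y η ∂(surface n) = (c : ℂ) * Y ζ

/-- The kernel `|1 - ζ·η̄|^{-2α}`. -/
def kernel₁ (n : ℕ) (α : ℝ) (ζ η : Sph n) : ℝ := ‖1 - dotConj ζ η‖ ^ (-2 * α)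

/-- The kernel `|ζ·η̄|² |1 - ζ·η̄|^{-2α}`. -/
def kernel₂ (n : ℕ) (α : ℝ) (ζ η : Sph n) : ℝ :=
  ‖dotConj ζ η‖ ^ 2 * ‖1 - dotConj ζ η‖ ^ (-2 * α)

/-- The expression `E_{j,k}` as a function of `α`. -/
def E (n j k : ℕ) (α : ℝ) : ℝ :=
  2 * Real.pi ^ (n + 1) * Real.Gamma (n + 1 - 2 * α) / Real.Gamma α ^ 2 *
    (Real.Gamma (j + α) / Real.Gamma (j + n + 1 - α)) *
    (Real.Gamma (k + α) / Real.Gamma (k + n + 1 - α))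

/-- The expression for the eigenvalue of the second kernel as a function of `α`. -/
def E' (n j k : ℕ) (α : ℝ) : ℝ :=
  E n j k α * (1 - (α - 1) * (n + 1 - 2 * α) * (2 * j * k + n * (j + k - 1 + α)) /
    ((j - 1 + α) * (j + n + 1 - α) * (k - 1 + α) * (k + n + 1 - α)))

end ComplexSphere

end

/-! Write w = ζ·η̄. The kernel (1 - w)^{-α} (1 - w̄)^{-β} is a double power series in w and w̄ with
coefficients (α)_a (β)_b / (a! b!), so its action on harmonic Y of bidegree (j, k) is determined by
the moments ∫ w^a w̄^b Y. Passing to a Gaussian integral over ℂ^{n+1} and integrating by parts turns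
each w into a derivative; harmonicity kills everything except a = j + m, b = k + m, where the moment
is an explicit multiple of Y(ζ) (`gaussInt_linbar_pow_mul_lin_pow_mul`,
`integral_dotConj_pow_mul_eq`).

The eigenvalue is therefore a multiple of ₂F₁(α + j, β + k; n + j + k + 1; 1), which Gauss's theorem
evaluates (`hasSum_gaussTerm`, `hasSum_eigenTerm`). Since the power series lives in |w| < 1, the
computation is made with rw for r < 1, followed by r → 1; Fatou's lemma gives integrability of the
singular kernel and dominated convergence gives the limit (`integrable_and_integral_powKernel_mul`).

The first kernel is the case β = α. For the second, |w|² = (1 - (1 - w))(1 - (1 - w̄)) gives four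
power kernels with exponents α or α - 1, and the stated factor is a rational identity between their
eigenvalues (`E'_eq_eigen₂`). Written with rising factorials, the eigenvalues are continuous at α =
0 and α = 1, which supplies the limits there. -/

noncomputable section

/-! ### Rising factorials and Gauss's summation theorem. -/

/-- The rising factorial `(a)_m = a (a + 1) ⋯ (a + m - 1)` of a real number. -/
def poch (a : ℝ) (m : ℕ) : ℝ := (ascPochhammer ℝ m).eval a

@[simp] lemma poch_zero (a : ℝ) : poch a 0 = 1 := by simp [poch]

lemma poch_succ (a : ℝ) (m : ℕ) : poch a (m + 1) = poch a m * (a + m) :=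
  ascPochhammer_succ_eval m a

lemma poch_succ_left (a : ℝ) (m : ℕ) : poch a (m + 1) = a * poch (a + 1) m := by
  simp [poch, ascPochhammer_succ_left, Polynomial.eval_comp]

lemma continuous_poch (m : ℕ) : Continuous fun a => poch a m :=
  (ascPochhammer ℝ m).continuous

lemma poch_pos {a : ℝ} (ha : 0 < a) (m : ℕ) : 0 < poch a m := ascPochhammer_pos m a ha

lemma poch_add (a : ℝ) (j m : ℕ) : poch a (j + m) = poch a j * poch (a + j) m := by
  induction m with
  | zero => simp
  | succ m ih => rw [← add_assoc, poch_succ, poch_succ, ih]; push_cast; ring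

lemma poch_mono {a b : ℝ} (ha : 0 < a) (h : a ≤ b) (m : ℕ) : poch a m ≤ poch b m := by
  induction m with
  | zero => simp
  | succ m ih =>
    rw [poch_succ, poch_succ]
    have := poch_pos (ha.trans_le h) m
    gcongr

lemma poch_eq_prod (a : ℝ) (m : ℕ) : poch a m = ∏ i ∈ Finset.range m, (a + i) := by
  induction m with
  | zero => simp
  | succ m ih => rw [poch_succ, Finset.prod_range_succ, ih]

lemma Gamma_mul_poch {a : ℝ} (ha : ∀ m : ℕ, a ≠ -m) (m : ℕ) :
    Real.Gamma a * poch a m = Real.Gamma (a + m) := by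
  induction m with
  | zero => simp
  | succ m ih =>
    have h : a + m ≠ 0 := fun h => ha m (by linarith)
    rw [poch_succ, ← mul_assoc, ih]
    push_cast
    rw [← add_assoc, Real.Gamma_add_one h]; ring

/-- `(a)_{m+1} / (m! m^a) → 1 / Γ(a)`. -/
lemma tendsto_poch_div {a : ℝ} (ha : ∀ m : ℕ, a ≠ -m) :
    Tendsto (fun m : ℕ => poch a (m + 1) / ((m : ℝ) ^ a * m.factorial)) atTop
      (𝓝 (Real.Gamma a)⁻¹) := by
  have h := (Real.GammaSeq_tendsto_Gamma a).inv₀ (Real.Gamma_ne_zero ha)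
  refine h.congr fun m => ?_
  rw [Real.GammaSeq, inv_div, poch_eq_prod]

lemma poch_isBigO (a : ℝ) :
    (fun m : ℕ => poch a (m + 1)) =O[atTop] fun m : ℕ => (m : ℝ) ^ a * m.factorial := by
  by_cases ha : ∀ m : ℕ, a ≠ -m
  · have h := (tendsto_poch_div ha).isBigO_one ℝ
    have h2 := h.mul (Asymptotics.isBigO_refl (fun m : ℕ => (m : ℝ) ^ a * m.factorial) atTop)
    refine (h2.congr' ?_ ?_)
    · filter_upwards [eventually_gt_atTop 0] with m hm
      have : (m : ℝ) ^ a * m.factorial ≠ 0 := by positivity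
      field_simp
    · filter_upwards with m using by simp
  · push Not at ha
    obtain ⟨k, rfl⟩ := ha
    -- At a = -k the product acquires a zero factor once m ≥ k, so the constant 0 suffices.
    refine Asymptotics.IsBigO.of_bound 0 ?_
    filter_upwards [eventually_ge_atTop k] with m hm
    have : poch (-(k : ℝ)) (m + 1) = 0 := by
      rw [poch_eq_prod]
      exact Finset.prod_eq_zero (Finset.mem_range.2 (Nat.lt_succ_of_le hm)) (by simp)
    simp [this]

lemma inv_poch_isBigO {c : ℝ} (hc : 0 < c) :
    (fun m : ℕ => (poch c (m + 1))⁻¹) =O[atTop] fun m : ℕ => ((m : ℝ) ^ c * m.factorial)⁻¹ := by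
  have h := (Real.GammaSeq_tendsto_Gamma c).isBigO_one ℝ
  have h2 := h.mul (Asymptotics.isBigO_refl (fun m : ℕ => ((m : ℝ) ^ c * m.factorial)⁻¹) atTop)
  refine (h2.congr' ?_ ?_)
  · filter_upwards [eventually_gt_atTop 0] with m hm
    have : (m : ℝ) ^ c * m.factorial ≠ 0 := by positivity
    have := (poch_pos hc (m + 1)).ne'
    rw [Real.GammaSeq, ← poch_eq_prod]
    field_simp
  · filter_upwards with m using by simp

/-- The general term of the hypergeometric series `₂F₁(a, b; c; 1)`. -/
def gaussTerm (a b c : ℝ) (m : ℕ) : ℝ := poch a m * poch b m / (poch c m * m.factorial)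

/-- The index m + 1 matches Euler's sequence for Γ, whose m-th product has m + 1 factors. The three
rising factorials contribute m^{a+b-c} m!, and 1/(m + 1)! contributes the remaining m^{-1} / m!. -/
lemma gaussTerm_isBigO (a b : ℝ) {c : ℝ} (hc : 0 < c) :
    (fun m : ℕ => gaussTerm a b c (m + 1)) =O[atTop] fun m : ℕ => (m : ℝ) ^ (a + b - c - 1) := by
  have h := ((poch_isBigO a).mul (poch_isBigO b)).mul (inv_poch_isBigO hc)
  have h4 : (fun m : ℕ => (((m + 1).factorial : ℕ) : ℝ)⁻¹) =O[atTop]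
      fun m : ℕ => (m : ℝ)⁻¹ * (m.factorial : ℝ)⁻¹ := by
    refine Asymptotics.IsBigO.of_bound 1 ?_
    filter_upwards [eventually_gt_atTop 0] with m hm
    have hm' : (0 : ℝ) < m := by exact_mod_cast hm
    rw [Nat.factorial_succ, Real.norm_of_nonneg (by positivity),
      Real.norm_of_nonneg (by positivity), one_mul]
    push_cast
    rw [mul_inv]
    gcongr
    linarith
  refine (h.mul h4).congr' ?_ ?_
  · filter_upwards with m
    rw [gaussTerm, div_eq_mul_inv, mul_inv]; ring
  · filter_upwards [eventually_gt_atTop 0] with m hm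
    have hm' : (0 : ℝ) < m := by exact_mod_cast hm
    rw [Real.rpow_sub hm', Real.rpow_sub hm', Real.rpow_add hm', Real.rpow_one]
    have : (m.factorial : ℝ) ≠ 0 := by positivity
    have := (Real.rpow_pos_of_pos hm' c).ne'
    field_simp

lemma summable_gaussTerm {a b c : ℝ} (hc : 0 < c) (h : a + b < c) :
    Summable (gaussTerm a b c) := by
  rw [← summable_nat_add_iff 1]
  exact summable_of_isBigO_nat (Real.summable_nat_rpow.2 (by linarith)) (gaussTerm_isBigO a b hc)

/-- Disposes of the boundary term of the telescoping sum in `tsum_gaussTerm_contiguous`. -/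
lemma tendsto_mul_gaussTerm {a b c : ℝ} (hc : 0 < c) (h : a + b < c) :
    Tendsto (fun m : ℕ => (m : ℝ) * gaussTerm a b c m) atTop (𝓝 0) := by
  rw [← tendsto_add_atTop_iff_nat 1]
  have h1 : (fun m : ℕ => ((m + 1 : ℕ) : ℝ)) =O[atTop] fun m : ℕ => (m : ℝ) := by
    refine Asymptotics.IsBigO.of_bound 2 ?_
    filter_upwards [eventually_gt_atTop 0] with m hm
    have hm' : (1 : ℝ) ≤ m := by exact_mod_cast hm
    rw [Real.norm_of_nonneg (by positivity), Real.norm_of_nonneg (by positivity)]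
    push_cast
    linarith
  refine (h1.mul (gaussTerm_isBigO a b hc)).trans_tendsto ?_
  have h2 : Tendsto (fun m : ℕ => (m : ℝ) ^ (-(c - a - b))) atTop (𝓝 0) :=
    (tendsto_rpow_neg_atTop (by linarith)).comp tendsto_natCast_atTop_atTop
  refine h2.congr' ?_
  filter_upwards [eventually_gt_atTop 0] with m hm
  have hm' : (0 : ℝ) < m := by exact_mod_cast hm
  rw [show a + b - c - 1 = -(c - a - b) - 1 by ring, Real.rpow_sub hm', Real.rpow_one]
  field_simp

lemma poch_add_one_left_mul (c : ℝ) (m : ℕ) : poch (c + 1) m * c = poch c m * (c + m) := by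
  rw [← poch_succ, poch_succ_left]; ring

/-- The contiguous relation between `₂F₁(a, b; c; 1)` and `₂F₁(a, b; c + 1; 1)`. -/
lemma tsum_gaussTerm_contiguous {a b c : ℝ} (hc : 0 < c) (h : a + b < c) :
    c * (c - a - b) * ∑' m, gaussTerm a b c m =
      (c - a) * (c - b) * ∑' m, gaussTerm a b (c + 1) m := by
  have s1 := (summable_gaussTerm hc h).mul_left (c * (c - a - b))
  have s2 := (summable_gaussTerm (by linarith : 0 < c + 1)
    (by linarith : a + b < c + 1)).mul_left ((c - a) * (c - b))
  rw [← tsum_mul_left, ← tsum_mul_left, ← sub_eq_zero, ← s1.tsum_sub s2]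
  -- The termwise difference is a discrete derivative of c · m · `gaussTerm a b c m`, which is 0 at
  -- m = 0 and tends to 0 at infinity.
  have key : ∀ m : ℕ, c * (c - a - b) * gaussTerm a b c m -
      (c - a) * (c - b) * gaussTerm a b (c + 1) m =
      c * (m * gaussTerm a b c m) - c * ((m + 1 : ℕ) * gaussTerm a b c (m + 1)) := by
    intro m
    have h1 := (poch_pos hc m).ne'
    have hcm : c + m ≠ 0 := by positivity
    have h3 : (m.factorial : ℝ) ≠ 0 := by positivity
    have h4 : ((m : ℝ) + 1) ≠ 0 := by positivity
    have h2 : poch (c + 1) m = poch c m * (c + m) / c := by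
      rw [← poch_add_one_left_mul]; field_simp
    simp only [gaussTerm, poch_succ, Nat.factorial_succ, h2]
    push_cast
    field_simp
    ring
  have t := (tendsto_mul_gaussTerm hc h).const_mul c
  rw [mul_zero] at t
  have hs := (s1.sub s2).hasSum.tendsto_sum_nat
  refine tendsto_nhds_unique hs ?_
  simp only [key, Finset.sum_range_sub']
  simpa using t.neg

/-- As the lower parameter grows, every term but the zeroth (equal to 1) tends to 0; the series at c
dominates because (c + N)_m ≥ (c)_m. -/
lemma tendsto_tsum_gaussTerm_add_nat {a b c : ℝ} (hc : 0 < c) (h : a + b < c) :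
    Tendsto (fun N : ℕ => ∑' m, gaussTerm a b (c + N) m) atTop (𝓝 1) := by
  have h1 : ∑' m : ℕ, (if m = 0 then (1 : ℝ) else 0) = 1 := by simp
  rw [← h1]
  refine tendsto_tsum_of_dominated_convergence (summable_gaussTerm hc h).norm ?_ ?_
  · intro m
    rcases m with _ | m
    · simp [gaussTerm]
    · simp only [Nat.add_eq_zero_iff, one_ne_zero, and_false, if_false]
      have ht : Tendsto (fun N : ℕ => poch (c + N) (m + 1)) atTop atTop := by
        have : Tendsto (fun N : ℕ => poch c m * (c + N)) atTop atTop :=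
          (tendsto_atTop_add_const_left _ c tendsto_natCast_atTop_atTop).const_mul_atTop
            (poch_pos hc m)
        refine tendsto_atTop_mono (fun N => ?_) this
        have hN : (0 : ℝ) ≤ N := N.cast_nonneg
        rw [poch_succ]
        have := poch_mono hc (by linarith : c ≤ c + N) m
        have := poch_pos hc m
        have hm : (0 : ℝ) ≤ m := m.cast_nonneg
        exact (mul_le_mul_of_nonneg_left (by linarith) this.le).trans
          (mul_le_mul_of_nonneg_right (by assumption) (by linarith))
      have h2 := (ht.inv_tendsto_atTop).const_mul
        (poch a (m + 1) * poch b (m + 1) * (((m + 1).factorial : ℕ) : ℝ)⁻¹)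
      rw [mul_zero] at h2
      refine h2.congr fun N => ?_
      simp only [gaussTerm, Pi.inv_apply]
      rw [div_eq_mul_inv, mul_inv]; ring
  · filter_upwards with N m
    have hN : (0 : ℝ) ≤ N := N.cast_nonneg
    have h1 := poch_mono hc (by linarith : c ≤ c + N) m
    have h2 := poch_pos hc m
    simp only [gaussTerm, norm_div, norm_mul]
    rw [Real.norm_of_nonneg h2.le, Real.norm_of_nonneg (h2.le.trans h1)]
    have h3 : 0 < ‖(m.factorial : ℝ)‖ := norm_pos_iff.2 (by positivity)
    have := mul_pos h2 h3
    gcongr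

lemma tendsto_Gamma_add_div {x : ℝ} (hx : 0 < x) :
    Tendsto (fun m : ℕ => Real.Gamma (x + (m + 1 : ℕ)) / ((m : ℝ) ^ x * m.factorial)) atTop
      (𝓝 1) := by
  have hx' : ∀ m : ℕ, x ≠ -m := fun m h => by
    have : (0 : ℝ) ≤ m := m.cast_nonneg
    linarith
  have h := (tendsto_poch_div hx').const_mul (Real.Gamma x)
  rw [mul_inv_cancel₀ (Real.Gamma_ne_zero hx')] at h
  refine h.congr fun m => ?_
  rw [← Gamma_mul_poch hx', mul_div_assoc]

/-- **Gauss's summation theorem** for `₂F₁(a, b; c; 1)`. -/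
theorem hasSum_gaussTerm {a b c : ℝ} (hc : 0 < c) (hca : a < c) (hcb : b < c) (h : a + b < c) :
    HasSum (gaussTerm a b c)
      (Real.Gamma c * Real.Gamma (c - a - b) / (Real.Gamma (c - a) * Real.Gamma (c - b))) := by
  -- G N is the series at c + N divided by its claimed value. The contiguous relation makes G
  -- constant and its limit is 1, hence G 0 = 1.
  set G : ℕ → ℝ := fun N => (∑' m, gaussTerm a b (c + N) m) *
    ((Real.Gamma (c - a + N) * Real.Gamma (c - b + N)) /
      (Real.Gamma (c + N) * Real.Gamma (c - a - b + N))) with hG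
  have hstep : ∀ N, G (N + 1) = G N := by
    intro N
    have hN : (0 : ℝ) ≤ N := N.cast_nonneg
    have hc1 : 0 < c + N := by linarith
    have hc2 : 0 < c - a + N := by linarith
    have hc3 : 0 < c - b + N := by linarith
    have hc4 : 0 < c - a - b + N := by linarith
    have := tsum_gaussTerm_contiguous (a := a) (b := b) hc1 (by linarith)
    simp only [hG]
    push_cast
    simp only [← add_assoc]
    rw [Real.Gamma_add_one hc1.ne', Real.Gamma_add_one hc2.ne', Real.Gamma_add_one hc3.ne',
      Real.Gamma_add_one hc4.ne']
    have g1 := (Real.Gamma_pos_of_pos hc1).ne'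
    have g4 := (Real.Gamma_pos_of_pos hc4).ne'
    rw [← mul_div_assoc, ← mul_div_assoc, div_eq_div_iff (by positivity) (by positivity)]
    linear_combination (-(Real.Gamma (c - a + N) * Real.Gamma (c - b + N) * Real.Gamma (c + N) *
      Real.Gamma (c - a - b + N))) * this
  have hconst : ∀ N, G N = G 0 := fun N => by
    induction N with
    | zero => rfl
    | succ N ih => rw [hstep, ih]
  have hlim : Tendsto G atTop (𝓝 1) := by
    rw [← tendsto_add_atTop_iff_nat 1]
    have l1 := (tendsto_tsum_gaussTerm_add_nat (a := a) (b := b) hc h).comp (tendsto_add_atTop_nat 1)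
    have la := tendsto_Gamma_add_div (sub_pos.2 hca)
    have lb := tendsto_Gamma_add_div (sub_pos.2 hcb)
    have lc := tendsto_Gamma_add_div hc
    have ld := tendsto_Gamma_add_div (by linarith : 0 < c - a - b)
    have l := l1.mul ((la.mul lb).div (lc.mul ld) (by norm_num))
    simp only [mul_one, div_one] at l
    refine l.congr' ?_
    filter_upwards [eventually_gt_atTop 0] with m hm
    have hm' : (0 : ℝ) < m := by exact_mod_cast hm
    have hN : (0 : ℝ) ≤ (m + 1 : ℕ) := Nat.cast_nonneg _
    simp only [hG, Function.comp, Pi.div_apply]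
    congr 1
    have f1 : (m.factorial : ℝ) ≠ 0 := by positivity
    have g1 := (Real.Gamma_pos_of_pos (by linarith : 0 < c + (m + 1 : ℕ))).ne'
    have g4 := (Real.Gamma_pos_of_pos (by linarith : 0 < c - a - b + (m + 1 : ℕ))).ne'
    have p1 := (Real.rpow_pos_of_pos hm' (c - a)).ne'
    have p2 := (Real.rpow_pos_of_pos hm' (c - b)).ne'
    have p3 := (Real.rpow_pos_of_pos hm' c).ne'
    have p4 := (Real.rpow_pos_of_pos hm' (c - a - b)).ne'
    -- Both sides carry the total exponent 2c - a - b, so the power asymptotics of the four Gamma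
    -- factors cancel.
    have e : (m : ℝ) ^ (c - a) * (m : ℝ) ^ (c - b) = (m : ℝ) ^ c * (m : ℝ) ^ (c - a - b) := by
      rw [← Real.rpow_add hm', ← Real.rpow_add hm']; ring_nf
    rw [div_mul_div_comm, div_mul_div_comm,
      show (m : ℝ) ^ (c - a) * m.factorial * ((m : ℝ) ^ (c - b) * m.factorial) =
        (m : ℝ) ^ c * m.factorial * ((m : ℝ) ^ (c - a - b) * m.factorial) by
        linear_combination ((m.factorial : ℝ) * m.factorial) * e,
      div_div_div_cancel_right₀ (by positivity)]
  have h0 : G 0 = 1 := tendsto_nhds_unique (tendsto_const_nhds.congr fun N => (hconst N).symm) hlim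
  have hsum : ∑' m, gaussTerm a b c m =
      Real.Gamma c * Real.Gamma (c - a - b) / (Real.Gamma (c - a) * Real.Gamma (c - b)) := by
    have ga := (Real.Gamma_pos_of_pos (sub_pos.2 hca)).ne'
    have gb := (Real.Gamma_pos_of_pos (sub_pos.2 hcb)).ne'
    have gc := (Real.Gamma_pos_of_pos hc).ne'
    have gd := (Real.Gamma_pos_of_pos (by linarith : 0 < c - a - b)).ne'
    simp only [hG, Nat.cast_zero, add_zero] at h0
    field_simp at h0 ⊢
    linarith
  rw [← hsum]
  exact (summable_gaussTerm hc h).hasSum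

namespace ComplexSphere

open MvPolynomial

variable {n : ℕ}

/-! ### Gaussian integrals of polynomials in z, z̄ and integration by parts. -/

/-- Evaluation of `p(z, z̄)` at a point of `ℂ^{n+1}`. -/
def ev (z : EuclideanSpace ℂ (Fin (n + 1))) : BiPoly n →ₐ[ℂ] ℂ :=
  aeval (Sum.elim (fun i => z i) (fun i => conj (z i)))

@[simp] lemma ev_C (z : EuclideanSpace ℂ (Fin (n + 1))) (a : ℂ) : ev z (C a) = a := by simp [ev]

@[simp] lemma ev_X_inl (z : EuclideanSpace ℂ (Fin (n + 1))) (i : Fin (n + 1)) :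
    ev z (X (Sum.inl i)) = z i := by simp [ev]

@[simp] lemma ev_X_inr (z : EuclideanSpace ℂ (Fin (n + 1))) (i : Fin (n + 1)) :
    ev z (X (Sum.inr i)) = conj (z i) := by simp [ev]

lemma continuous_ev (p : BiPoly n) : Continuous fun z => ev z p := by
  induction p using MvPolynomial.induction_on with
  | C a => simpa using continuous_const
  | add p q hp hq => simp only [map_add]; exact hp.add hq
  | mul_X p i hp =>
    rcases i with i | i <;> simp only [map_mul, ev_X_inl, ev_X_inr]
    · exact hp.mul (by fun_prop)
    · exact hp.mul (Complex.continuous_conj.comp (by fun_prop))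

/-- Allowing every ε > 0 makes the bound stable under multiplication by a variable: one half of ε
goes to the polynomial, the other absorbs |z|. -/
lemma exists_norm_ev_le (p : BiPoly n) {ε : ℝ} (hε : 0 < ε) :
    ∃ K : ℝ, 0 ≤ K ∧ ∀ z, ‖ev z p‖ ≤ K * Real.exp (ε * ‖z‖ ^ 2) := by
  induction p using MvPolynomial.induction_on generalizing ε with
  | C a =>
    refine ⟨‖a‖, norm_nonneg a, fun z => ?_⟩
    rw [ev_C]
    exact le_mul_of_one_le_right (norm_nonneg a) (Real.one_le_exp (by positivity))
  | add p q hp hq =>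
    obtain ⟨K, hK, hp⟩ := hp hε
    obtain ⟨L, hL, hq⟩ := hq hε
    refine ⟨K + L, by positivity, fun z => ?_⟩
    rw [map_add, add_mul]
    exact (norm_add_le _ _).trans (add_le_add (hp z) (hq z))
  | mul_X p i hp =>
    obtain ⟨K, hK, hp⟩ := hp (half_pos hε)
    refine ⟨K * (1 + 2 / ε), by positivity, fun z => ?_⟩
    have h1 : ‖ev z (X i : BiPoly n)‖ ≤ ‖z‖ := by
      rcases i with i | i
      · simpa using PiLp.norm_apply_le z i
      · simpa using PiLp.norm_apply_le z i
    have h2 : ‖z‖ ≤ (1 + 2 / ε) * Real.exp (ε / 2 * ‖z‖ ^ 2) := by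
      have h3 := Real.add_one_le_exp (ε / 2 * ‖z‖ ^ 2)
      calc ‖z‖ ≤ 1 + ‖z‖ ^ 2 := by nlinarith [sq_nonneg (‖z‖ - 1)]
        _ ≤ (1 + 2 / ε) * (ε / 2 * ‖z‖ ^ 2 + 1) := by
          have : (1 + 2 / ε) * (ε / 2 * ‖z‖ ^ 2 + 1) =
            1 + ‖z‖ ^ 2 + (ε / 2 * ‖z‖ ^ 2 + 2 / ε) := by field_simp; ring
          rw [this]
          have : 0 ≤ ε / 2 * ‖z‖ ^ 2 + 2 / ε := by positivity
          linarith
        _ ≤ _ := by gcongr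
    rw [map_mul, norm_mul]
    calc ‖ev z p‖ * ‖ev z (X i : BiPoly n)‖
        ≤ (K * Real.exp (ε / 2 * ‖z‖ ^ 2)) * ((1 + 2 / ε) * Real.exp (ε / 2 * ‖z‖ ^ 2)) :=
          mul_le_mul (hp z) (h1.trans h2) (norm_nonneg _) (by positivity)
      _ = K * (1 + 2 / ε) * Real.exp (ε / 2 * ‖z‖ ^ 2 + ε / 2 * ‖z‖ ^ 2) := by
          rw [Real.exp_add]; ring
      _ = _ := by ring_nf

lemma integrable_exp_neg_mul_sq_norm (n : ℕ) {b : ℝ} (hb : 0 < b) :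
    Integrable fun z : EuclideanSpace ℂ (Fin (n + 1)) => Real.exp (-b * ‖z‖ ^ 2) := by
  -- A non-integrable function has Bochner integral 0 by convention, contradicting the positive
  -- value of the Gaussian integral.
  by_contra h
  have h1 := GaussianFourier.integral_rexp_neg_mul_sq_norm
    (V := EuclideanSpace ℂ (Fin (n + 1))) hb
  rw [integral_undef h] at h1
  exact (Real.rpow_pos_of_pos (by positivity) _).ne h1

lemma integrable_ev_mul_exp (p : BiPoly n) :
    Integrable fun z : EuclideanSpace ℂ (Fin (n + 1)) =>
      ev z p * (Real.exp (-‖z‖ ^ 2) : ℂ) := by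
  obtain ⟨K, -, hK⟩ := exists_norm_ev_le p (ε := 1 / 2) (by norm_num)
  refine ((integrable_exp_neg_mul_sq_norm n (b := 1 / 2) (by norm_num)).const_mul K).mono' ?_ ?_
  · refine ((continuous_ev p).mul ?_).aestronglyMeasurable
    fun_prop
  · filter_upwards with z
    rw [norm_mul, Complex.norm_real, Real.norm_of_nonneg (Real.exp_pos _).le]
    calc _ ≤ K * Real.exp (1 / 2 * ‖z‖ ^ 2) * Real.exp (-‖z‖ ^ 2) := by gcongr; exact hK z
      _ = _ := by rw [mul_assoc, ← Real.exp_add]; ring_nf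

/-- The Gaussian integral `∫ p(z, z̄) e^{-|z|²} dz` of a polynomial over `ℂ^{n+1}`. -/
def gaussInt (n : ℕ) : BiPoly n →ₗ[ℂ] ℂ where
  toFun p := ∫ z : EuclideanSpace ℂ (Fin (n + 1)), ev z p * (Real.exp (-‖z‖ ^ 2) : ℂ)
  map_add' p q := by
    rw [← integral_add (integrable_ev_mul_exp p) (integrable_ev_mul_exp q)]
    simp only [map_add, add_mul]
  map_smul' a p := by
    rw [RingHom.id_apply, smul_eq_mul, ← integral_const_mul]
    simp only [map_smul, smul_eq_mul, mul_assoc]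

lemma gaussInt_apply (p : BiPoly n) : gaussInt n p =
    ∫ z : EuclideanSpace ℂ (Fin (n + 1)), ev z p * (Real.exp (-‖z‖ ^ 2) : ℂ) := rfl

lemma finrank_vec (n : ℕ) : Module.finrank ℝ (EuclideanSpace ℂ (Fin (n + 1))) = 2 * (n + 1) := by
  have := Module.finrank_mul_finrank ℝ ℂ (EuclideanSpace ℂ (Fin (n + 1)))
  rw [← this]; simp

lemma gaussInt_one (n : ℕ) : gaussInt n 1 = (Real.pi : ℂ) ^ (n + 1) := by
  have h1 := GaussianFourier.integral_rexp_neg_mul_sq_norm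
    (V := EuclideanSpace ℂ (Fin (n + 1))) one_pos
  rw [gaussInt_apply]
  simp only [map_one, one_mul]
  rw [integral_complex_ofReal]
  simp only [neg_mul, one_mul] at h1
  rw [h1, finrank_vec]
  push_cast
  rw [div_one, mul_div_cancel_left₀ _ (by norm_num : (2 : ℝ) ≠ 0)]
  norm_cast

/-- The derivation `∑ vᵢ ∂/∂zᵢ`. -/
def dz (v : EuclideanSpace ℂ (Fin (n + 1))) : Derivation ℂ (BiPoly n) (BiPoly n) :=
  ∑ i, v i • pderiv (Sum.inl i)

/-- The derivation `∑ v̄ᵢ ∂/∂z̄ᵢ`. -/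
def dzbar (v : EuclideanSpace ℂ (Fin (n + 1))) : Derivation ℂ (BiPoly n) (BiPoly n) :=
  ∑ i, conj (v i) • pderiv (Sum.inr i)

/-- The polynomial `v · z̄`. -/
def linbar (v : EuclideanSpace ℂ (Fin (n + 1))) : BiPoly n := ∑ i, v i • X (Sum.inr i)

/-- The polynomial `z · v̄`. -/
def lin (v : EuclideanSpace ℂ (Fin (n + 1))) : BiPoly n := ∑ i, conj (v i) • X (Sum.inl i)

/-- The polynomial `|z|²`. -/
def normSqPoly (n : ℕ) : BiPoly n := ∑ i, X (Sum.inl i) * X (Sum.inr i)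

lemma derivation_sum_apply {ι : Type*} (s : Finset ι) (D : ι → Derivation ℂ (BiPoly n) (BiPoly n))
    (p : BiPoly n) : (∑ i ∈ s, D i) p = ∑ i ∈ s, D i p := by
  classical
  induction s using Finset.induction_on with
  | empty => simp
  | insert a s ha ih => rw [Finset.sum_insert ha, Finset.sum_insert ha, Derivation.add_apply, ih]

lemma dz_apply (v : EuclideanSpace ℂ (Fin (n + 1))) (p : BiPoly n) :
    dz v p = ∑ i, v i • pderiv (Sum.inl i) p := by
  simp [dz, derivation_sum_apply]

lemma dzbar_apply (v : EuclideanSpace ℂ (Fin (n + 1))) (p : BiPoly n) :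
    dzbar v p = ∑ i, conj (v i) • pderiv (Sum.inr i) p := by
  simp [dzbar, derivation_sum_apply]

@[simp] lemma dz_X_inl (v : EuclideanSpace ℂ (Fin (n + 1))) (i : Fin (n + 1)) :
    dz v (X (Sum.inl i)) = C (v i) := by
  simp [dz_apply, pderiv_X, Pi.single_apply, smul_eq_C_mul]

@[simp] lemma dz_X_inr (v : EuclideanSpace ℂ (Fin (n + 1))) (i : Fin (n + 1)) :
    dz v (X (Sum.inr i)) = 0 := by
  simp [dz_apply, pderiv_X]

@[simp] lemma dzbar_X_inl (v : EuclideanSpace ℂ (Fin (n + 1))) (i : Fin (n + 1)) :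
    dzbar v (X (Sum.inl i)) = 0 := by
  simp [dzbar_apply, pderiv_X]

@[simp] lemma dzbar_X_inr (v : EuclideanSpace ℂ (Fin (n + 1))) (i : Fin (n + 1)) :
    dzbar v (X (Sum.inr i)) = C (conj (v i)) := by
  simp [dzbar_apply, pderiv_X, Pi.single_apply, smul_eq_C_mul]

lemma hasLineDerivAt_ev (p : BiPoly n) (z v : EuclideanSpace ℂ (Fin (n + 1))) :
    HasLineDerivAt ℝ (fun z => ev z p) (ev z (dz v p) + ev z (dzbar v p)) z v := by
  unfold HasLineDerivAt
  induction p using MvPolynomial.induction_on with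
  | C a =>
    have h1 : dz v (C a : BiPoly n) = 0 := (dz v).map_algebraMap a
    have h2 : dzbar v (C a : BiPoly n) = 0 := (dzbar v).map_algebraMap a
    simpa [h1, h2] using hasDerivAt_const (0 : ℝ) a
  | add p q hp hq =>
    simp only [map_add]
    exact (hp.fun_add hq).congr_deriv (by ring)
  | mul_X p i hp =>
    simp only [map_mul, Derivation.leibniz, smul_eq_mul, map_add]
    have hX : HasDerivAt (fun t : ℝ => ev (z + t • v) (X i : BiPoly n))
        (ev z (dz v (X i)) + ev z (dzbar v (X i))) 0 := by
      rcases i with i | i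
      · simp only [ev_X_inl, dz_X_inl, dzbar_X_inl, ev_C, map_zero, add_zero, PiLp.add_apply,
          PiLp.smul_apply]
        simpa using ((hasDerivAt_id (0 : ℝ)).smul_const (v i)).const_add (z i)
      · simp only [ev_X_inr, dz_X_inr, dzbar_X_inr, ev_C, map_zero, zero_add, PiLp.add_apply,
          PiLp.smul_apply, map_add]
        have h : ∀ t : ℝ, conj (t • v i) = t • conj (v i) := by simp
        simp only [h]
        simpa using ((hasDerivAt_id (0 : ℝ)).smul_const (conj (v i))).const_add (conj (z i))
    refine (hp.fun_mul hX).congr_deriv ?_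
    simp only [zero_smul, add_zero]
    ring

lemma ev_normSqPoly (z : EuclideanSpace ℂ (Fin (n + 1))) :
    ev z (normSqPoly n) = ((‖z‖ ^ 2 : ℝ) : ℂ) := by
  simp [normSqPoly, EuclideanSpace.norm_sq_eq, Complex.mul_conj, Complex.normSq_eq_norm_sq]

lemma dz_normSqPoly (v : EuclideanSpace ℂ (Fin (n + 1))) : dz v (normSqPoly n) = linbar v := by
  simp [normSqPoly, linbar, smul_eq_C_mul, mul_comm]

lemma dzbar_normSqPoly (v : EuclideanSpace ℂ (Fin (n + 1))) :
    dzbar v (normSqPoly n) = lin v := by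
  simp [normSqPoly, lin, smul_eq_C_mul, mul_comm]

lemma hasLineDerivAt_exp_neg (z v : EuclideanSpace ℂ (Fin (n + 1))) :
    HasLineDerivAt ℝ (fun z : EuclideanSpace ℂ (Fin (n + 1)) => (Real.exp (-‖z‖ ^ 2) : ℂ))
      (-(ev z (linbar v + lin v)) * (Real.exp (-‖z‖ ^ 2) : ℂ)) z v := by
  have h : ∀ z : EuclideanSpace ℂ (Fin (n + 1)), (Real.exp (-‖z‖ ^ 2) : ℂ) =
      Complex.exp (-ev z (normSqPoly n)) := fun z => by rw [ev_normSqPoly]; push_cast; rfl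
  simp only [h]
  have h1 := hasLineDerivAt_ev (normSqPoly n) z v
  rw [dz_normSqPoly, dzbar_normSqPoly, ← map_add] at h1
  unfold HasLineDerivAt at h1 ⊢
  convert! h1.neg.cexp using 1
  simp [mul_comm]

lemma gaussInt_dz_add_dzbar (v : EuclideanSpace ℂ (Fin (n + 1))) (p : BiPoly n) :
    gaussInt n (dz v p) + gaussInt n (dzbar v p) =
      gaussInt n (linbar v * p) + gaussInt n (lin v * p) := by
  have h := integral_bilinear_hasLineDerivAt_right_eq_neg_left_of_integrable
    (μ := (volume : Measure (EuclideanSpace ℂ (Fin (n + 1))))) (v := v)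
    (B := ContinuousLinearMap.mul ℝ ℂ)
    (f := fun z => ev z p) (f' := fun z => ev z (dz v p + dzbar v p))
    (g := fun z => (Real.exp (-‖z‖ ^ 2) : ℂ))
    (g' := fun z => -(ev z (linbar v + lin v)) * (Real.exp (-‖z‖ ^ 2) : ℂ))
    (integrable_ev_mul_exp _) ?_ (integrable_ev_mul_exp _)
    (fun z _ => by simpa using hasLineDerivAt_ev p z v)
    (fun z _ => hasLineDerivAt_exp_neg z v)
  · rw [← map_add, ← map_add, ← add_mul, gaussInt_apply, gaussInt_apply]
    simp only [ContinuousLinearMap.mul_apply'] at h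
    rw [← neg_eq_iff_eq_neg, ← integral_neg] at h
    rw [← h]
    congr 1
    ext z
    rw [map_mul]; ring
  · convert! (integrable_ev_mul_exp ((linbar v + lin v) * p)).neg using 1
    ext z
    simp only [ContinuousLinearMap.mul_apply', map_mul, Pi.neg_apply]
    ring

lemma dz_I_smul (v : EuclideanSpace ℂ (Fin (n + 1))) (p : BiPoly n) :
    dz (Complex.I • v) p = Complex.I • dz v p := by
  simp [dz_apply, Finset.smul_sum, mul_smul]

lemma dzbar_I_smul (v : EuclideanSpace ℂ (Fin (n + 1))) (p : BiPoly n) :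
    dzbar (Complex.I • v) p = -Complex.I • dzbar v p := by
  simp [dzbar_apply, Finset.smul_sum, mul_smul]

lemma linbar_I_smul (v : EuclideanSpace ℂ (Fin (n + 1))) :
    linbar (Complex.I • v) = Complex.I • linbar v := by
  simp [linbar, Finset.smul_sum, mul_smul]

lemma lin_I_smul (v : EuclideanSpace ℂ (Fin (n + 1))) :
    lin (Complex.I • v) = -Complex.I • lin v := by
  simp [lin, Finset.smul_sum, mul_smul]

/-- Real integration by parts along v gives only the sum of the two identities. Along iv the
holomorphic and antiholomorphic parts are multiplied by i and -i up to exchange of sides, which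
gives their difference. -/
lemma gaussInt_ibp (v : EuclideanSpace ℂ (Fin (n + 1))) (p : BiPoly n) :
    gaussInt n (linbar v * p) = gaussInt n (dz v p) ∧
    gaussInt n (lin v * p) = gaussInt n (dzbar v p) := by
  have h1 := gaussInt_dz_add_dzbar v p
  have h2 := gaussInt_dz_add_dzbar (Complex.I • v) p
  rw [dz_I_smul, dzbar_I_smul, linbar_I_smul, lin_I_smul, smul_mul_assoc, smul_mul_assoc,
    map_smul, map_smul, map_smul, map_smul] at h2
  simp only [smul_eq_mul] at h2
  have h3 : Complex.I * (gaussInt n (dz v p) - gaussInt n (dzbar v p)) =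
      Complex.I * (gaussInt n (linbar v * p) - gaussInt n (lin v * p)) := by
    linear_combination h2
  have h4 := mul_left_cancel₀ Complex.I_ne_zero h3
  constructor
  · linear_combination (-1 / 2 : ℂ) * h1 - (1 / 2 : ℂ) * h4
  · linear_combination (-1 / 2 : ℂ) * h1 + (1 / 2 : ℂ) * h4

lemma gaussInt_linbar_mul (v : EuclideanSpace ℂ (Fin (n + 1))) (p : BiPoly n) :
    gaussInt n (linbar v * p) = gaussInt n (dz v p) := (gaussInt_ibp v p).1

lemma gaussInt_lin_mul (v : EuclideanSpace ℂ (Fin (n + 1))) (p : BiPoly n) :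
    gaussInt n (lin v * p) = gaussInt n (dzbar v p) := (gaussInt_ibp v p).2

/-! ### Harmonic polynomials of given bidegree. -/

/-- The weight counting the degree in `z`. -/
abbrev wz (n : ℕ) : Fin (n + 1) ⊕ Fin (n + 1) → ℕ := Sum.elim (fun _ => 1) (fun _ => 0)

/-- The weight counting the degree in `z̄`. -/
abbrev wzbar (n : ℕ) : Fin (n + 1) ⊕ Fin (n + 1) → ℕ := Sum.elim (fun _ => 0) (fun _ => 1)

lemma quarterLaplacian_apply (p : BiPoly n) :
    quarterLaplacian n p = ∑ i, pderiv (Sum.inl i) (pderiv (Sum.inr i) p) := by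
  simp [quarterLaplacian]

lemma mem_harmonicPoly {j k : ℕ} {p : BiPoly n} : p ∈ harmonicPoly n j k ↔
    IsWeightedHomogeneous (wz n) p j ∧ IsWeightedHomogeneous (wzbar n) p k ∧
      quarterLaplacian n p = 0 := by
  simp only [harmonicPoly, Submodule.mem_inf, LinearMap.mem_ker,
    mem_weightedHomogeneousSubmodule, and_assoc]

lemma pderiv_comm {σ R : Type*} [CommRing R] (a b : σ) (p : MvPolynomial σ R) :
    pderiv a (pderiv b p) = pderiv b (pderiv a p) := by
  classical
  have h : ⁅(pderiv a : Derivation R (MvPolynomial σ R) (MvPolynomial σ R)),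
      (pderiv b : Derivation R (MvPolynomial σ R) (MvPolynomial σ R))⁆ = 0 := by
    refine MvPolynomial.derivation_ext fun i => ?_
    rw [Derivation.commutator_apply]
    simp [pderiv_X, Pi.single_apply, apply_ite]
  have h2 := congrArg (fun D => D p) h
  rw [Derivation.commutator_apply] at h2
  exact sub_eq_zero.1 h2

lemma quarterLaplacian_pderiv (a : Fin (n + 1) ⊕ Fin (n + 1)) (p : BiPoly n) :
    quarterLaplacian n (pderiv a p) = pderiv a (quarterLaplacian n p) := by
  simp only [quarterLaplacian_apply, map_sum]
  refine Finset.sum_congr rfl fun i _ => ?_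
  rw [pderiv_comm (Sum.inr i) a, pderiv_comm (Sum.inl i) a]

lemma pderiv_inl_mem {j k : ℕ} {p : BiPoly n} (hp : p ∈ harmonicPoly n (j + 1) k)
    (i : Fin (n + 1)) : pderiv (Sum.inl i) p ∈ harmonicPoly n j k := by
  rw [mem_harmonicPoly] at hp ⊢
  exact ⟨hp.1.pderiv (by simp), hp.2.1.pderiv (by simp), by
    rw [quarterLaplacian_pderiv, hp.2.2, map_zero]⟩

lemma pderiv_inr_mem {j k : ℕ} {p : BiPoly n} (hp : p ∈ harmonicPoly n j (k + 1))
    (i : Fin (n + 1)) : pderiv (Sum.inr i) p ∈ harmonicPoly n j k := by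
  rw [mem_harmonicPoly] at hp ⊢
  exact ⟨hp.1.pderiv (by simp), hp.2.1.pderiv (by simp), by
    rw [quarterLaplacian_pderiv, hp.2.2, map_zero]⟩

lemma dz_mem {j k : ℕ} {p : BiPoly n} (hp : p ∈ harmonicPoly n (j + 1) k)
    (v : EuclideanSpace ℂ (Fin (n + 1))) : dz v p ∈ harmonicPoly n j k := by
  rw [dz_apply]
  exact Submodule.sum_mem _ fun i _ => Submodule.smul_mem _ _ (pderiv_inl_mem hp i)

lemma dzbar_mem {j k : ℕ} {p : BiPoly n} (hp : p ∈ harmonicPoly n j (k + 1))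
    (v : EuclideanSpace ℂ (Fin (n + 1))) : dzbar v p ∈ harmonicPoly n j k := by
  rw [dzbar_apply]
  exact Submodule.sum_mem _ fun i _ => Submodule.smul_mem _ _ (pderiv_inr_mem hp i)

lemma pderiv_eq_zero_of_weight_zero {σ : Type*} {w : σ → ℕ} {p : MvPolynomial σ ℂ}
    (hp : IsWeightedHomogeneous w p 0) {i : σ} (hi : w i = 1) : pderiv i p = 0 := by
  refine pderiv_eq_zero_of_notMem_vars fun h => ?_
  obtain ⟨d, hd, hid⟩ := (mem_vars_iff_mem_support i).1 h
  have h1 := hp (mem_support_iff.1 hd)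
  have h2 := Finsupp.le_weight w (show w i ≠ 0 by omega) d
  rw [h1] at h2
  exact (Finsupp.mem_support_iff.1 hid) (by omega)

lemma dz_eq_zero {k : ℕ} {p : BiPoly n} (hp : p ∈ harmonicPoly n 0 k)
    (v : EuclideanSpace ℂ (Fin (n + 1))) : dz v p = 0 := by
  rw [dz_apply]
  refine Finset.sum_eq_zero fun i _ => ?_
  rw [pderiv_eq_zero_of_weight_zero (mem_harmonicPoly.1 hp).1 (by simp), smul_zero]

lemma dzbar_eq_zero {j : ℕ} {p : BiPoly n} (hp : p ∈ harmonicPoly n j 0)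
    (v : EuclideanSpace ℂ (Fin (n + 1))) : dzbar v p = 0 := by
  rw [dzbar_apply]
  refine Finset.sum_eq_zero fun i _ => ?_
  rw [pderiv_eq_zero_of_weight_zero (mem_harmonicPoly.1 hp).2.1 (by simp), smul_zero]

lemma euler_z {j k : ℕ} {p : BiPoly n} (hp : p ∈ harmonicPoly n j k) :
    ∑ i, X (Sum.inl i) * pderiv (Sum.inl i) p = j • p := by
  have h := (mem_harmonicPoly.1 hp).1.sum_weight_X_mul_pderiv
  simpa using h

lemma euler_zbar {j k : ℕ} {p : BiPoly n} (hp : p ∈ harmonicPoly n j k) :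
    ∑ i, X (Sum.inr i) * pderiv (Sum.inr i) p = k • p := by
  have h := (mem_harmonicPoly.1 hp).2.1.sum_weight_X_mul_pderiv
  simpa using h

lemma ev_dz_self {j k : ℕ} {p : BiPoly n} (hp : p ∈ harmonicPoly n j k)
    (v : EuclideanSpace ℂ (Fin (n + 1))) : ev v (dz v p) = j * ev v p := by
  have h := congrArg (ev v) (euler_z hp)
  rw [dz_apply]
  simpa using h

lemma ev_dzbar_self {j k : ℕ} {p : BiPoly n} (hp : p ∈ harmonicPoly n j k)
    (v : EuclideanSpace ℂ (Fin (n + 1))) : ev v (dzbar v p) = k * ev v p := by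
  have h := congrArg (ev v) (euler_zbar hp)
  rw [dzbar_apply]
  simpa using h

lemma gaussInt_X_inl_mul (i : Fin (n + 1)) (p : BiPoly n) :
    gaussInt n (X (Sum.inl i) * p) = gaussInt n (pderiv (Sum.inr i) p) := by
  have h := gaussInt_lin_mul (EuclideanSpace.single i 1) p
  simpa [lin, dzbar_apply, PiLp.single_apply, apply_ite, ite_smul] using h

lemma gaussInt_X_inr_mul (i : Fin (n + 1)) (p : BiPoly n) :
    gaussInt n (X (Sum.inr i) * p) = gaussInt n (pderiv (Sum.inl i) p) := by
  have h := gaussInt_linbar_mul (EuclideanSpace.single i 1) p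
  simpa [linbar, dz_apply, PiLp.single_apply, apply_ite, ite_smul] using h

/-- By Euler's identity and integration by parts, j ∫ p = ∑ ∫ zᵢ ∂ᵢp = ∑ ∫ ∂̄ᵢ∂ᵢp = 0, and likewise
with k. -/
lemma gaussInt_harmonic_eq_zero {j k : ℕ} {p : BiPoly n} (hp : p ∈ harmonicPoly n j k)
    (h : j ≠ 0 ∨ k ≠ 0) : gaussInt n p = 0 := by
  have hΔ : ∑ i, gaussInt n (pderiv (Sum.inl i) (pderiv (Sum.inr i) p)) = 0 := by
    rw [← map_sum, ← quarterLaplacian_apply, (mem_harmonicPoly.1 hp).2.2, map_zero]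
  rcases h with h | h
  · have h1 := congrArg (gaussInt n) (euler_z hp)
    rw [map_sum] at h1
    simp only [gaussInt_X_inl_mul] at h1
    simp only [fun i => pderiv_comm (Sum.inr i) (Sum.inl i) p] at h1
    rw [hΔ, map_nsmul] at h1
    exact (smul_eq_zero.1 h1.symm).resolve_left h
  · have h1 := congrArg (gaussInt n) (euler_zbar hp)
    rw [map_sum] at h1
    simp only [gaussInt_X_inr_mul] at h1
    rw [hΔ, map_nsmul] at h1
    exact (smul_eq_zero.1 h1.symm).resolve_left h

lemma weight_add_weight (d : Fin (n + 1) ⊕ Fin (n + 1) →₀ ℕ) :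
    Finsupp.weight (wz n) d + Finsupp.weight (wzbar n) d = ∑ i, d i := by
  simp [Finsupp.weight_apply, Finsupp.sum_fintype, Fintype.sum_sum_type]

lemma eq_C_of_mem {p : BiPoly n} (hp : p ∈ harmonicPoly n 0 0) : p = C (coeff 0 p) := by
  rw [mem_harmonicPoly] at hp
  ext d
  rw [coeff_C]
  split_ifs with h
  · rw [h]
  · by_contra hd
    have h1 := hp.1 hd
    have h2 := hp.2.1 hd
    have h3 := weight_add_weight d
    rw [h1, h2] at h3
    have h4 := (Finset.sum_eq_zero_iff.1 h3.symm)
    exact h (Finsupp.ext fun i => (h4 i (Finset.mem_univ i)).symm)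

lemma gaussInt_of_mem_zero {p : BiPoly n} (hp : p ∈ harmonicPoly n 0 0)
    (v : EuclideanSpace ℂ (Fin (n + 1))) :
    gaussInt n p = (Real.pi : ℂ) ^ (n + 1) * ev v p := by
  rw [eq_C_of_mem hp, ev_C, ← mul_one (C _), ← smul_eq_C_mul, map_smul, gaussInt_one, smul_eq_mul,
    mul_comm]

/-! ### Gaussian moments of harmonic polynomials. -/

lemma dz_linbar (v : EuclideanSpace ℂ (Fin (n + 1))) : dz v (linbar v) = 0 := by
  simp [linbar]

lemma dzbar_lin (v : EuclideanSpace ℂ (Fin (n + 1))) : dzbar v (lin v) = 0 := by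
  simp [lin]

lemma dz_lin {v : EuclideanSpace ℂ (Fin (n + 1))} (hv : ‖v‖ = 1) : dz v (lin v) = 1 := by
  have h : ∑ i, conj (v i) * v i = 1 := by
    have h1 := ev_normSqPoly v
    rw [hv] at h1
    simpa [normSqPoly, mul_comm] using h1
  simp only [lin, map_sum, Derivation.map_smul, dz_X_inl]
  simp only [smul_eq_C_mul, ← C_mul]
  rw [← map_sum, h, C_1]

/-- The coefficient in the Gaussian integral of `(ζ · z̄)^a (z · ζ̄)^b Y` for `Y` harmonic
of bidegree `(j, k)`. -/
def gaussCoeff (a b j k : ℕ) : ℂ :=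
  if a + k = b + j ∧ j ≤ a then (a.factorial : ℂ) * b.factorial / ((a - j).factorial : ℂ) else 0

lemma gaussCoeff_zero_zero {j k : ℕ} (h : j ≠ 0 ∨ k ≠ 0) : gaussCoeff 0 0 j k = 0 := by
  rw [gaussCoeff, if_neg (by omega)]

lemma gaussCoeff_zero_succ_zero (b j : ℕ) : gaussCoeff 0 (b + 1) j 0 = 0 := by
  rw [gaussCoeff, if_neg (by omega)]

lemma gaussCoeff_zero_succ_succ (b j k : ℕ) :
    gaussCoeff 0 (b + 1) j (k + 1) = (k + 1 : ℕ) * gaussCoeff 0 b j k := by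
  simp only [gaussCoeff]
  by_cases h : 0 + k = b + j ∧ j ≤ 0
  · obtain ⟨h1, h2⟩ := h
    obtain rfl : j = 0 := by omega
    obtain rfl : k = b := by omega
    rw [if_pos (by omega), if_pos (by omega)]
    rw [Nat.factorial_succ]; push_cast; simp
  · rw [if_neg (by omega), if_neg h, mul_zero]

lemma gaussCoeff_succ_zero (a b k : ℕ) :
    gaussCoeff (a + 1) b 0 k = b * gaussCoeff a (b - 1) 0 k := by
  rcases b with _ | b
  · rw [gaussCoeff, if_neg (by omega)]; simp
  · simp only [gaussCoeff, Nat.add_sub_cancel, Nat.sub_zero]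
    have h1 : (a.factorial : ℂ) ≠ 0 := by exact_mod_cast a.factorial_ne_zero
    have h2 : ((a + 1).factorial : ℂ) ≠ 0 := by exact_mod_cast (a + 1).factorial_ne_zero
    by_cases h : a + k = b
    · rw [if_pos (by omega), if_pos (by omega), Nat.factorial_succ b]
      push_cast
      field_simp
    · rw [if_neg (by omega), if_neg (by omega), mul_zero]

/-- This is the recursion produced by trading one factor v·z̄ for a derivative: it hits one of the b
factors z·v̄, or the polynomial, where Euler's identity at v yields j + 1. At b = 0 the truncated `b
- 1` is harmless because of the factor b. -/
lemma gaussCoeff_succ_succ (a b j k : ℕ) : gaussCoeff (a + 1) b (j + 1) k =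
    b * gaussCoeff a (b - 1) (j + 1) k + (j + 1 : ℕ) * gaussCoeff a b j k := by
  simp only [gaussCoeff]
  by_cases h : a + k = b + j ∧ j ≤ a
  · obtain ⟨h1, h2⟩ := h
    obtain ⟨m, rfl⟩ := Nat.exists_eq_add_of_le h2
    rw [if_pos (by omega), show j + m + 1 - (j + 1) = m by omega,
      show j + m - j = m by omega, show j + m - (j + 1) = m - 1 by omega]
    rcases m with _ | m
    · rw [if_neg (by omega), if_pos (by omega), add_zero, Nat.factorial_succ]
      push_cast
      simp
      ring
    · obtain ⟨b, rfl⟩ : ∃ b', b = b' + 1 := ⟨b - 1, by omega⟩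
      rw [if_pos (by omega), if_pos (by omega), Nat.add_sub_cancel, Nat.add_sub_cancel,
        Nat.factorial_succ (j + (m + 1)), Nat.factorial_succ m, Nat.factorial_succ b]
      have h3 : (m.factorial : ℂ) ≠ 0 := by exact_mod_cast m.factorial_ne_zero
      have h4 : (m : ℂ) + 1 ≠ 0 := by exact_mod_cast m.succ_ne_zero
      push_cast
      field_simp
      ring
  · rw [if_neg (by omega), if_neg h]
    rcases b with _ | b
    · simp
    · rw [if_neg (by omega)]; simp

/-- Each factor z·v̄ becomes `dzbar v`, which annihilates the other such factors and only lowers the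
degree k of p. -/
lemma gaussInt_lin_pow_mul {v : EuclideanSpace ℂ (Fin (n + 1))} (b : ℕ) {j k : ℕ} {p : BiPoly n}
    (hp : p ∈ harmonicPoly n j k) : gaussInt n (lin v ^ b * p) =
      (Real.pi : ℂ) ^ (n + 1) * gaussCoeff 0 b j k * ev v p := by
  induction b generalizing k p with
  | zero =>
    rw [pow_zero, one_mul]
    by_cases h : j ≠ 0 ∨ k ≠ 0
    · rw [gaussInt_harmonic_eq_zero hp h, gaussCoeff_zero_zero h]; ring
    · push Not at h
      obtain ⟨rfl, rfl⟩ := h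
      rw [gaussInt_of_mem_zero hp v]
      simp [gaussCoeff]
  | succ b ih =>
    rw [pow_succ', mul_assoc, gaussInt_lin_mul, Derivation.leibniz, Derivation.leibniz_pow,
      dzbar_lin, smul_zero, smul_zero, smul_zero, add_zero, smul_eq_mul]
    rcases k with _ | k
    · rw [dzbar_eq_zero hp, gaussCoeff_zero_succ_zero]; simp
    · rw [ih (dzbar_mem hp v), ev_dzbar_self hp, gaussCoeff_zero_succ_succ]; ring

/-- Each factor v·z̄ becomes `dz v`, which annihilates v·z̄, sends z·v̄ to |v|² = 1 and keeps p
harmonic. All derivatives of p are along v, so after they are exhausted Euler's identity leaves a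
multiple of p(v). -/
theorem gaussInt_linbar_pow_mul_lin_pow_mul {v : EuclideanSpace ℂ (Fin (n + 1))} (hv : ‖v‖ = 1)
    (a b : ℕ) {j k : ℕ} {p : BiPoly n} (hp : p ∈ harmonicPoly n j k) :
    gaussInt n (linbar v ^ a * (lin v ^ b * p)) =
      (Real.pi : ℂ) ^ (n + 1) * gaussCoeff a b j k * ev v p := by
  induction a generalizing b j p with
  | zero => rw [pow_zero, one_mul, gaussInt_lin_pow_mul b hp]
  | succ a ih =>
    have h : dz v (linbar v ^ a * (lin v ^ b * p)) =
        (b : ℂ) • (linbar v ^ a * (lin v ^ (b - 1) * p)) +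
          linbar v ^ a * (lin v ^ b * dz v p) := by
      rw [Derivation.leibniz, Derivation.leibniz_pow, dz_linbar, Derivation.leibniz,
        Derivation.leibniz_pow, dz_lin hv]
      simp only [smul_eq_mul, mul_one, nsmul_eq_mul, smul_eq_C_mul,
        map_natCast]
      ring
    rw [pow_succ', mul_assoc, gaussInt_linbar_mul, h, map_add, map_smul, ih _ hp, smul_eq_mul]
    rcases j with _ | j
    · rw [dz_eq_zero hp, gaussCoeff_succ_zero]; simp; ring
    · rw [ih _ (dz_mem hp v), ev_dz_self hp, gaussCoeff_succ_succ]; ring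

/-! ### From Gaussian integrals to moments on the sphere. -/

instance : IsFiniteMeasure (surface n) := by unfold surface; infer_instance

/-- Polar coordinates for a positively homogeneous function against a radial weight. -/
lemma integral_mul_radial {E : Type*} [NormedAddCommGroup E] [NormedSpace ℝ E]
    [MeasurableSpace E] [Nontrivial E] [FiniteDimensional ℝ E] [BorelSpace E]
    (μ : Measure E) [μ.IsAddHaarMeasure] (f : E → ℂ) (g : ℝ → ℝ) (d : ℕ)
    (hf : ∀ r : ℝ, 0 < r → ∀ z, f (r • z) = (r : ℂ) ^ d * f z) :
    ∫ z, f z * (g ‖z‖ : ℂ) ∂μ = (∫ η : Metric.sphere (0 : E) 1, f η ∂μ.toSphere) *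
      ((∫ r in Set.Ioi (0 : ℝ), r ^ (Module.finrank ℝ E - 1) * (r ^ d * g r) : ℝ) : ℂ) := by
  have h1 : ∫ z : E, f z * (g ‖z‖ : ℂ) ∂μ =
      ∫ z : ({(0 : E)}ᶜ : Set E), f z * (g ‖(z : E)‖ : ℂ) ∂(μ.comap (↑)) := by
    rw [integral_subtype_comap (measurableSet_singleton _).compl fun x : E => f x * (g ‖x‖ : ℂ),
      restrict_compl_singleton]
  have h2 := μ.measurePreserving_homeomorphUnitSphereProd.integral_comp
    (Homeomorph.measurableEmbedding _)
    (fun x : Metric.sphere (0 : E) 1 × Set.Ioi (0 : ℝ) =>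
      f x.1 * (((x.2 : ℝ) ^ d * g x.2 : ℝ) : ℂ))
  have h3 : ∀ z : ({(0 : E)}ᶜ : Set E), f z * (g ‖(z : E)‖ : ℂ) =
      f ((homeomorphUnitSphereProd E z).1 : E) *
        ((((homeomorphUnitSphereProd E z).2 : ℝ) ^ d * g (homeomorphUnitSphereProd E z).2 : ℝ)
          : ℂ) := by
    intro z
    have hz : 0 < ‖(z : E)‖ := norm_pos_iff.2 z.2
    -- Homogeneity is applied to z = |z| · (z/|z|), separating the angular and radial variables.
    have h := hf ‖(z : E)‖ hz (‖(z : E)‖⁻¹ • (z : E))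
    rw [smul_inv_smul₀ hz.ne'] at h
    simp only [homeomorphUnitSphereProd_apply_snd_coe, homeomorphUnitSphereProd_apply_fst_coe]
    rw [h]
    push_cast
    ring
  rw [h1]
  simp only [h3]
  rw [h2, integral_prod_mul (fun x : Metric.sphere (0 : E) 1 => f x)
    (fun r : Set.Ioi (0 : ℝ) => (((r : ℝ) ^ d * g r : ℝ) : ℂ)), integral_complex_ofReal]
  congr 2
  simp only [Measure.volumeIoiPow, ENNReal.ofReal]
  rw [integral_withDensity_eq_integral_smul,
    integral_subtype_comap measurableSet_Ioi fun a : ℝ =>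
      Real.toNNReal (a ^ (Module.finrank ℝ E - 1)) • (a ^ d * g a),
    setIntegral_congr_fun measurableSet_Ioi fun x hx => ?_]
  · rw [NNReal.smul_def, Real.coe_toNNReal _ (pow_nonneg (le_of_lt hx) _), smul_eq_mul]
  · exact (measurable_subtype_coe.pow_const _).real_toNNReal

lemma integral_mul_gaussian (f : EuclideanSpace ℂ (Fin (n + 1)) → ℂ) (d : ℕ)
    (hf : ∀ r : ℝ, 0 < r → ∀ z, f (r • z) = (r : ℂ) ^ d * f z) :
    ∫ z, f z * (Real.exp (-‖z‖ ^ 2) : ℂ) = (∫ η : Sph n, f η ∂(surface n)) *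
      ((Real.Gamma (n + 1 + d / 2) / 2 : ℝ) : ℂ) := by
  rw [integral_mul_radial volume f (fun r => Real.exp (-r ^ 2)) d hf, finrank_vec,
    show 2 * (n + 1) - 1 = 2 * n + 1 by omega, surface]
  congr 2
  have h := integral_rpow_mul_exp_neg_rpow (p := 2) (q := 2 * n + 1 + d) (by norm_num)
    (by linarith [(n.cast_nonneg : (0 : ℝ) ≤ n), (d.cast_nonneg : (0 : ℝ) ≤ d)])
  rw [show (2 * (n : ℝ) + 1 + d + 1) / 2 = n + 1 + d / 2 by ring] at h
  rw [show ∀ x : ℝ, x / 2 = 1 / 2 * x by intro x; ring, ← h]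
  refine setIntegral_congr_fun measurableSet_Ioi fun r hr => ?_
  have h2 : (2 * (n : ℝ) + 1 + d) = ((2 * n + 1 + d : ℕ) : ℝ) := by push_cast; ring
  simp only [h2, Real.rpow_natCast, Real.rpow_ofNat]
  ring

lemma ev_smul_of_mem {j k : ℕ} {p : BiPoly n} (hp : p ∈ harmonicPoly n j k) (r : ℝ)
    (z : EuclideanSpace ℂ (Fin (n + 1))) : ev (r • z) p = (r : ℂ) ^ (j + k) * ev z p := by
  rw [mem_harmonicPoly] at hp
  simp only [ev, aeval_def, eval₂_eq']
  rw [Finset.mul_sum]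
  refine Finset.sum_congr rfl fun d hd => ?_
  have h1 := hp.1 (mem_support_iff.1 hd)
  have h2 := hp.2.1 (mem_support_iff.1 hd)
  have h3 := weight_add_weight d
  rw [h1, h2] at h3
  rw [h3, ← Finset.prod_pow_eq_pow_sum, mul_left_comm, ← Finset.prod_mul_distrib]
  congr 1
  refine Finset.prod_congr rfl fun i _ => ?_
  rw [← mul_pow]
  rcases i with i | i <;> simp

lemma ev_linbar (v z : EuclideanSpace ℂ (Fin (n + 1))) :
    ev z (linbar v) = ∑ i, v i * conj (z i) := by simp [linbar]

lemma ev_lin (v z : EuclideanSpace ℂ (Fin (n + 1))) :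
    ev z (lin v) = conj (∑ i, v i * conj (z i)) := by simp [lin]

lemma ev_smul_linbar (v z : EuclideanSpace ℂ (Fin (n + 1))) (r : ℝ) :
    ev (r • z) (linbar v) = r * ev z (linbar v) := by
  simp [ev_linbar, Finset.mul_sum, mul_left_comm]

lemma ev_smul_lin (v z : EuclideanSpace ℂ (Fin (n + 1))) (r : ℝ) :
    ev (r • z) (lin v) = r * ev z (lin v) := by
  rw [ev_lin, ← ev_linbar, ev_smul_linbar, map_mul, Complex.conj_ofReal, ev_linbar, ev_lin]

/-- The integrand is homogeneous of degree a + b + j + k, so its Gaussian integral is the spherical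
moment times one radial Gamma integral. -/
lemma integral_dotConj_pow_mul (ζ : Sph n) (a b : ℕ) {j k : ℕ} {p : BiPoly n}
    (hp : p ∈ harmonicPoly n j k) :
    (∫ η : Sph n, dotConj ζ η ^ a * conj (dotConj ζ η) ^ b * ev η p ∂(surface n)) *
      ((Real.Gamma (n + 1 + (a + b + j + k : ℕ) / 2) / 2 : ℝ) : ℂ) =
      (Real.pi : ℂ) ^ (n + 1) * gaussCoeff a b j k * ev ζ p := by
  have hζ : ‖(ζ : EuclideanSpace ℂ (Fin (n + 1)))‖ = 1 := by simp
  rw [← gaussInt_linbar_pow_mul_lin_pow_mul hζ a b hp, gaussInt_apply]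
  have hg := integral_mul_gaussian
    (fun z => ev z (linbar (ζ : EuclideanSpace ℂ (Fin (n + 1))) ^ a *
      (lin (ζ : EuclideanSpace ℂ (Fin (n + 1))) ^ b * p))) (a + b + j + k) fun r _ z => by
        simp only [map_mul, map_pow, ev_smul_linbar, ev_smul_lin, ev_smul_of_mem hp]
        ring
  beta_reduce at hg
  rw [hg]
  simp only [map_mul, map_pow, ev_linbar, ev_lin, dotConj, mul_assoc]

lemma integral_dotConj_pow_mul_eq_zero (ζ : Sph n) {a b j k : ℕ} {p : BiPoly n}
    (hp : p ∈ harmonicPoly n j k) (h : ¬∃ m, a = j + m ∧ b = k + m) :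
    ∫ η : Sph n, dotConj ζ η ^ a * conj (dotConj ζ η) ^ b * ev η p ∂(surface n) = 0 := by
  have h1 := integral_dotConj_pow_mul ζ a b hp
  have h2 : gaussCoeff a b j k = 0 := by
    rw [gaussCoeff, if_neg]
    rintro ⟨h2, h3⟩
    exact h ⟨a - j, by omega, by omega⟩
  rw [h2, mul_zero, zero_mul] at h1
  refine (mul_eq_zero.1 h1).resolve_right ?_
  have := Real.Gamma_pos_of_pos (by positivity : 0 < (n : ℝ) + 1 + (a + b + j + k : ℕ) / 2)
  exact_mod_cast (half_pos this).ne'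

lemma integral_dotConj_pow_mul_eq (ζ : Sph n) {j k : ℕ} {p : BiPoly n}
    (hp : p ∈ harmonicPoly n j k) (m : ℕ) :
    ∫ η : Sph n, dotConj ζ η ^ (j + m) * conj (dotConj ζ η) ^ (k + m) * ev η p ∂(surface n) =
      ((2 * Real.pi ^ (n + 1) * ((j + m).factorial * (k + m).factorial /
        (m.factorial * (n + j + k + m).factorial)) : ℝ) : ℂ) * ev ζ p := by
  have h1 := integral_dotConj_pow_mul ζ (j + m) (k + m) hp
  -- The total degree is 2(j + k + m), so the Gamma factor is a factorial.
  have h2 : Real.Gamma (n + 1 + (j + m + (k + m) + j + k : ℕ) / 2) =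
      ((n + j + k + m).factorial : ℝ) := by
    rw [← Real.Gamma_nat_eq_factorial]
    congr 1
    push_cast
    ring
  rw [h2, gaussCoeff, if_pos (by omega), Nat.add_sub_cancel_left] at h1
  have h3 : ((n + j + k + m).factorial : ℂ) ≠ 0 := by
    exact_mod_cast (n + j + k + m).factorial_ne_zero
  have h4 : (m.factorial : ℂ) ≠ 0 := by exact_mod_cast m.factorial_ne_zero
  push_cast at h1 ⊢
  field_simp at h1 ⊢
  linear_combination h1

end ComplexSphere

/-! ### The binomial series and the power kernels. -/

lemma ofReal_poch (a : ℝ) (m : ℕ) : (poch a m : ℂ) = (ascPochhammer ℂ m).eval (a : ℂ) := by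
  induction m with
  | zero => simp
  | succ m ih => rw [poch_succ, ascPochhammer_succ_eval, ← ih]; push_cast; ring

lemma choose_add_sub_one (a : ℝ) (m : ℕ) :
    Ring.choose ((a : ℂ) + m - 1) m = ((poch a m / m.factorial : ℝ) : ℂ) := by
  rw [Ring.choose_eq_smul, Polynomial.descPochhammer_smeval_eq_ascPochhammer,
    Polynomial.ascPochhammer_smeval_cast, Polynomial.ascPochhammer_smeval_eq_eval,
    show (a : ℂ) + m - 1 - m + 1 = a by ring, ← ofReal_poch, smul_eq_mul]
  push_cast
  ring

lemma hasSum_one_sub_cpow_neg (a : ℝ) {w : ℂ} (hw : ‖w‖ < 1) :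
    HasSum (fun m : ℕ => ((poch a m / m.factorial : ℝ) : ℂ) * w ^ m) ((1 - w) ^ (-(a : ℂ))) := by
  have h := (Complex.one_div_one_sub_cpow_hasFPowerSeriesOnBall_zero (a : ℂ)).hasSum
    (y := w) (by simpa [← ofReal_norm] using hw)
  simp only [zero_add, FormalMultilinearSeries.ofScalars_apply_eq, smul_eq_mul] at h
  rw [Complex.cpow_neg, ← one_div]
  simpa only [choose_add_sub_one] using h

namespace ComplexSphere

/-- The function `(1 - w)^{-α} (1 - w̄)^{-β}`. -/
def powKernel (α β : ℝ) (w : ℂ) : ℂ := (1 - w) ^ (-(α : ℂ)) * (1 - conj w) ^ (-(β : ℂ))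

lemma hasSum_mul_prod {f g : ℕ → ℂ} {s t : ℂ} (hf : HasSum f s) (hg : HasSum g t) :
    HasSum (fun x : ℕ × ℕ => f x.1 * g x.2) (s * t) := by
  have h : Summable fun x : ℕ × ℕ => f x.1 * g x.2 :=
    summable_mul_of_summable_norm hf.summable.norm hg.summable.norm
  exact hf.mul hg h

lemma hasSum_powKernel (α β : ℝ) {w : ℂ} (hw : ‖w‖ < 1) :
    HasSum (fun x : ℕ × ℕ => ((poch α x.1 / x.1.factorial : ℝ) : ℂ) * w ^ x.1 *
      (((poch β x.2 / x.2.factorial : ℝ) : ℂ) * conj w ^ x.2)) (powKernel α β w) := by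
  have hw' : ‖conj w‖ < 1 := by rwa [Complex.norm_conj]
  have h := hasSum_mul_prod (hasSum_one_sub_cpow_neg α hw) (hasSum_one_sub_cpow_neg β hw')
  beta_reduce at h
  rw [powKernel]
  exact h

lemma re_one_sub_pos {w : ℂ} (hw : ‖w‖ ≤ 1) (h1 : w ≠ 1) : 0 < (1 - w).re := by
  have h := Complex.re_le_norm w
  have h2 : w.re ≠ 1 := by
    intro h2
    have h3 := Complex.sq_norm_sub_sq_re w
    have h4 : w.im = 0 := by nlinarith [norm_nonneg w, sq_nonneg w.im]
    exact h1 (Complex.ext (by simpa using h2) (by simpa using h4))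
  have : w.re < 1 := lt_of_le_of_ne (h.trans hw) h2
  simpa using this

lemma norm_powKernel (α β : ℝ) {w : ℂ} (h1 : w ≠ 1) :
    ‖powKernel α β w‖ = ‖1 - w‖ ^ (-(α + β)) := by
  have h : (1 - w) ≠ 0 := sub_ne_zero.2 h1.symm
  have h2 : ‖1 - conj w‖ = ‖1 - w‖ := by
    rw [← Complex.norm_conj (1 - w)]; simp
  have h3 : (1 - conj w) ≠ 0 := by rw [← norm_ne_zero_iff, h2]; exact norm_ne_zero_iff.2 h
  rw [powKernel, norm_mul, ← Complex.ofReal_neg, ← Complex.ofReal_neg,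
    Complex.norm_cpow_real, Complex.norm_cpow_real, h2, ← Real.rpow_add (norm_pos_iff.2 h)]
  ring_nf

lemma powKernel_self (α : ℝ) {w : ℂ} (hw : ‖w‖ ≤ 1) :
    powKernel α α w = ((‖1 - w‖ ^ (-2 * α) : ℝ) : ℂ) := by
  -- Since Re (1 - w) ≥ 0, the point 1 - w is off the branch cut, and conjugation commutes with the
  -- principal power.
  have harg : (1 - w).arg ≠ Real.pi := by
    intro h
    have := (Complex.arg_eq_pi_iff.1 h).1
    have h2 := Complex.re_le_norm w
    simp at this
    linarith
  have h := Complex.cpow_conj (1 - w) (-(α : ℂ)) harg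
  simp only [map_sub, map_one, map_neg, Complex.conj_ofReal] at h
  rw [powKernel, h, mul_comm, Complex.mul_conj, Complex.normSq_eq_norm_sq, ← Complex.ofReal_neg,
    Complex.norm_cpow_real, ← Real.rpow_natCast, ← Real.rpow_mul (norm_nonneg _)]
  have h2 : ‖1 - conj w‖ = ‖1 - w‖ := by
    rw [← Complex.norm_conj (1 - w)]; simp
  rw [h2]
  congr 2
  push_cast
  ring

lemma powKernel_sub_one (α β : ℝ) {w : ℂ} (h1 : w ≠ 1) :
    powKernel (α - 1) β w = (1 - w) * powKernel α β w := by
  have h : (1 - w) ≠ 0 := sub_ne_zero.2 h1.symm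
  simp only [powKernel]
  rw [show (-((α - 1 : ℝ) : ℂ)) = -(α : ℂ) + 1 by push_cast; ring, Complex.cpow_add _ _ h,
    Complex.cpow_one]
  ring

lemma powKernel_sub_one_right (α β : ℝ) {w : ℂ} (h1 : w ≠ 1) :
    powKernel α (β - 1) w = (1 - conj w) * powKernel α β w := by
  have h : (1 - conj w) ≠ 0 := by
    rw [← map_one (starRingEnd ℂ), ← map_sub, map_ne_zero]
    exact sub_ne_zero.2 h1.symm
  simp only [powKernel]
  rw [show (-((β - 1 : ℝ) : ℂ)) = -(β : ℂ) + 1 by push_cast; ring, Complex.cpow_add _ _ h,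
    Complex.cpow_one]
  ring

lemma continuousAt_powKernel (α β : ℝ) {w : ℂ} (hw : ‖w‖ ≤ 1) (h1 : w ≠ 1) :
    ContinuousAt (powKernel α β) w := by
  have h := re_one_sub_pos hw h1
  have h2 : 0 < (1 - conj w).re := by simpa using h
  unfold powKernel
  refine ContinuousAt.mul ?_ ?_
  · exact ContinuousAt.cpow (by fun_prop) continuousAt_const (Or.inl h)
  · refine ContinuousAt.cpow ?_ continuousAt_const (Or.inl h2)
    exact continuousAt_const.sub Complex.continuous_conj.continuousAt

lemma measurable_powKernel (α β : ℝ) : Measurable (powKernel α β) := by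
  unfold powKernel
  have h : Measurable (fun w : ℂ => conj w) := Complex.continuous_conj.measurable
  exact ((measurable_const.sub measurable_id).pow_const _).mul ((measurable_const.sub h).pow_const _)

lemma norm_one_sub_le {w : ℂ} (hw : ‖w‖ ≤ 1) {r : ℝ} (h0 : 0 ≤ r) (h1 : r ≤ 1) :
    ‖1 - w‖ ≤ 2 * ‖1 - r * w‖ := by
  have e1 : ‖1 - w‖ ≤ ‖1 - r * w‖ + ‖((1 - r : ℝ) : ℂ) * w‖ := by
    have : 1 - w = (1 - r * w) - ((1 - r : ℝ) : ℂ) * w := by push_cast; ring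
    rw [this]; exact norm_sub_le _ _
  have e2 : ‖((1 - r : ℝ) : ℂ) * w‖ ≤ 1 - r := by
    rw [norm_mul, Complex.norm_real, Real.norm_of_nonneg (by linarith)]
    exact mul_le_of_le_one_right (by linarith) hw
  have e3 : 1 - r ≤ ‖1 - r * w‖ := by
    have h2 := norm_sub_norm_le (1 : ℂ) (r * w)
    rw [norm_mul, Complex.norm_real, Real.norm_of_nonneg h0, norm_one] at h2
    nlinarith
  linarith

/-- A majorant independent of r, for dominated convergence as r → 1. A negative power of |1 - rw| is
controlled by |1 - w| ≤ 2|1 - rw|, a positive one by |1 - rw| ≤ 2. -/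
lemma norm_powKernel_mul_le (α β : ℝ) {w : ℂ} (hw : ‖w‖ ≤ 1) (hw1 : w ≠ 1) {r : ℝ} (h0 : 0 ≤ r)
    (h1 : r < 1) :
    ‖powKernel α β (r * w)‖ ≤ 2 ^ |α + β| * (‖1 - w‖ ^ (-(α + β)) + 1) := by
  have hrw : ‖(r : ℂ) * w‖ < 1 := by
    rw [norm_mul, Complex.norm_real, Real.norm_of_nonneg h0]
    nlinarith [norm_nonneg w]
  have hne : (r : ℂ) * w ≠ 1 := fun h => by rw [h, norm_one] at hrw; exact lt_irrefl _ hrw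
  have hp : 0 < ‖1 - w‖ := norm_pos_iff.2 (sub_ne_zero.2 hw1.symm)
  have hp2 : 0 < ‖1 - r * w‖ := norm_pos_iff.2 (sub_ne_zero.2 hne.symm)
  have hpow : 0 ≤ ‖1 - w‖ ^ (-(α + β)) := by positivity
  have h2 : (0 : ℝ) < 2 ^ |α + β| := by positivity
  rw [norm_powKernel _ _ hne]
  rcases le_total 0 (α + β) with hs | hs
  · have h3 := norm_one_sub_le hw h0 h1.le
    calc ‖1 - r * w‖ ^ (-(α + β)) ≤ (‖1 - w‖ / 2) ^ (-(α + β)) :=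
          Real.rpow_le_rpow_of_nonpos (by positivity) (by linarith) (by linarith)
      _ = 2 ^ |α + β| * ‖1 - w‖ ^ (-(α + β)) := by
          rw [Real.div_rpow hp.le (by norm_num), Real.rpow_neg (by norm_num : (0 : ℝ) ≤ 2),
            abs_of_nonneg hs, div_inv_eq_mul, mul_comm]
      _ ≤ _ := by nlinarith
  · have h3 : ‖1 - r * w‖ ≤ 2 := by
      have := norm_sub_le (1 : ℂ) (r * w)
      rw [norm_one] at this
      linarith
    calc ‖1 - r * w‖ ^ (-(α + β)) ≤ 2 ^ (-(α + β)) :=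
          Real.rpow_le_rpow hp2.le h3 (by linarith)
      _ = 2 ^ |α + β| := by rw [abs_of_nonpos hs]
      _ ≤ _ := by nlinarith

variable {n : ℕ}

/-! ### The kernels on the sphere and the eigenvalue series. -/

lemma dotConj_eq_inner (ζ η : Sph n) :
    dotConj ζ η = inner ℂ (η : EuclideanSpace ℂ (Fin (n + 1))) (ζ : EuclideanSpace ℂ (Fin (n + 1))) := by
  simp [dotConj, PiLp.inner_apply]

lemma norm_dotConj_le (ζ η : Sph n) : ‖dotConj ζ η‖ ≤ 1 := by
  rw [dotConj_eq_inner]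
  simpa using norm_inner_le_norm (𝕜 := ℂ) (η : EuclideanSpace ℂ (Fin (n + 1))) ζ

lemma continuous_dotConj (ζ : Sph n) : Continuous fun η => dotConj ζ η := by
  simp only [dotConj_eq_inner]
  fun_prop

lemma surface_singleton (ζ : Sph n) : surface n {ζ} = 0 := by
  rw [surface, Measure.toSphere_apply' _ (measurableSet_singleton ζ), Set.image_singleton]
  refine mul_eq_zero_of_right _ ?_
  -- The cone over a point lies in a real line, a proper subspace since the real dimension is 2n +
  -- 2, hence a null set.
  set S : Submodule ℝ (EuclideanSpace ℂ (Fin (n + 1))) := Submodule.span ℝ {(ζ : EuclideanSpace ℂ (Fin (n + 1)))}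
  have hS : S ≠ ⊤ := by
    intro h
    have h1 := finrank_span_singleton (K := ℝ) (ne_zero_of_mem_unit_sphere ζ)
    change Module.finrank ℝ S = 1 at h1
    rw [h, finrank_top, finrank_vec] at h1
    omega
  refine measure_mono_null ?_ (Measure.addHaar_submodule volume S hS)
  rintro _ ⟨r, -, _, rfl, rfl⟩
  exact S.smul_mem r (Submodule.mem_span_singleton_self _)

lemma ae_dotConj_ne_one (ζ : Sph n) : ∀ᵐ η ∂(surface n), dotConj ζ η ≠ 1 := by
  have h : ∀ᵐ η ∂(surface n), η ≠ ζ := by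
    rw [ae_iff]; simpa using surface_singleton ζ
  filter_upwards [h] with η hη h1
  rw [dotConj_eq_inner, inner_eq_one_iff_of_norm_eq_one (by simp) (by simp)] at h1
  exact hη (Subtype.ext h1)

/-- The terms of the series for the eigenvalue of `(1 - ζ·η̄)^{-α} (1 - η·ζ̄)^{-β}`. -/
def eigenTerm (n j k : ℕ) (α β : ℝ) (m : ℕ) : ℝ :=
  2 * Real.pi ^ (n + 1) * (poch α (j + m) * poch β (k + m) /
    (m.factorial * (n + j + k + m).factorial))

/-- The eigenvalue on `𝓗_{j,k}` of the kernel `(1 - ζ·η̄)^{-α} (1 - η·ζ̄)^{-β}`. -/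
def eigen (n j k : ℕ) (α β : ℝ) : ℝ :=
  2 * Real.pi ^ (n + 1) * Real.Gamma (n + 1 - α - β) *
    (poch α j / Real.Gamma (j + n + 1 - β)) * (poch β k / Real.Gamma (k + n + 1 - α))

/-- Splitting (α)_{j+m} = (α)_j (α + j)_m, and similarly for β and the factorial, exhibits ₂F₁(α +
j, β + k; n + j + k + 1; 1). -/
lemma hasSum_eigenTerm (j k : ℕ) {α β : ℝ} (hα : α < n + 1) (hβ : β < n + 1)
    (h : α + β < n + 1) : HasSum (eigenTerm n j k α β) (eigen n j k α β) := by
  have hj : (0 : ℝ) ≤ j := j.cast_nonneg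
  have hk : (0 : ℝ) ≤ k := k.cast_nonneg
  have hn : (0 : ℝ) ≤ n := n.cast_nonneg
  have hc : (0 : ℝ) < n + j + k + 1 := by positivity
  have hG := hasSum_gaussTerm (a := α + j) (b := β + k) hc (by linarith) (by linarith)
    (by linarith)
  have hfac : ∀ m : ℕ, ((n + j + k + m).factorial : ℝ) =
      (n + j + k).factorial * poch (n + j + k + 1) m := by
    intro m
    have h1 := Gamma_mul_poch (a := n + j + k + 1) (fun m hm => by
      have : (0 : ℝ) ≤ m := m.cast_nonneg
      linarith) m
    rw [← Real.Gamma_nat_eq_factorial, ← Real.Gamma_nat_eq_factorial]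
    push_cast
    rw [h1]
    congr 1
    ring
  have hf0 : ((n + j + k).factorial : ℝ) ≠ 0 := by positivity
  have h2 := hG.mul_left (2 * Real.pi ^ (n + 1) * poch α j * poch β k / (n + j + k).factorial)
  convert! h2 using 1
  · ext m
    rw [eigenTerm, gaussTerm, poch_add, poch_add, hfac]
    rw [div_mul_div_comm, ← mul_div_assoc]
    congr 1 <;> ring
  · have hΓ : Real.Gamma (n + j + k + 1) = (n + j + k).factorial := by
      rw [← Real.Gamma_nat_eq_factorial]; push_cast; rfl
    rw [eigen, hΓ, show (n : ℝ) + j + k + 1 - (α + j) - (β + k) = n + 1 - α - β by ring,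
      show (n : ℝ) + j + k + 1 - (α + j) = k + n + 1 - α by ring,
      show (n : ℝ) + j + k + 1 - (β + k) = j + n + 1 - β by ring]
    have g1 := (Real.Gamma_pos_of_pos (by linarith : 0 < (k : ℝ) + n + 1 - α)).ne'
    have g2 := (Real.Gamma_pos_of_pos (by linarith : 0 < (j : ℝ) + n + 1 - β)).ne'
    field_simp

lemma exists_norm_ev_sphere_le (p : BiPoly n) : ∃ M, ∀ η : Sph n, ‖ev η p‖ ≤ M := by
  obtain ⟨K, -, hK⟩ := exists_norm_ev_le p one_pos
  exact ⟨K * Real.exp (1 * 1 ^ 2), fun η => by simpa using hK η⟩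

lemma continuous_ev_sphere (p : BiPoly n) : Continuous fun η : Sph n => ev η p :=
  (continuous_ev p).comp continuous_subtype_val

/-- For r < 1 the double series is dominated uniformly on the sphere and may be integrated termwise;
orthogonality leaves only the indices (j + m, k + m). -/
lemma hasSum_integral_powKernel_mul (α β : ℝ) (ζ : Sph n) {j k : ℕ} {p : BiPoly n}
    (hp : p ∈ harmonicPoly n j k) {r : ℝ} (h0 : 0 ≤ r) (h1 : r < 1) :
    HasSum (fun m => ((r ^ (j + k + 2 * m) * eigenTerm n j k α β m : ℝ) : ℂ) * ev ζ p)
      (∫ η : Sph n, powKernel α β (r * dotConj ζ η) * ev η p ∂(surface n)) := by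
  obtain ⟨M, hM⟩ := exists_norm_ev_sphere_le p
  set c : ℝ → ℕ → ℝ := fun a m => poch a m / m.factorial with hc
  have hr : ‖(r : ℂ)‖ < 1 := by rwa [Complex.norm_real, Real.norm_of_nonneg h0]
  have hsum : ∀ a : ℝ, Summable fun m => ‖c a m‖ * r ^ m := fun a => by
    have := (hasSum_one_sub_cpow_neg a hr).summable.norm
    simpa [hc, abs_of_nonneg h0] using this
  set F : ℕ × ℕ → Sph n → ℂ := fun x η =>
    (((c α x.1 * c β x.2) * r ^ (x.1 + x.2) : ℝ) : ℂ) *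
      (dotConj ζ η ^ x.1 * conj (dotConj ζ η) ^ x.2 * ev η p) with hF
  set B : ℕ × ℕ → ℝ := fun x => ((‖c α x.1‖ * r ^ x.1) * (‖c β x.2‖ * r ^ x.2)) * M with hB
  have hBs : Summable B := ((hsum α).mul_of_nonneg (hsum β) (fun m => by positivity)
    (fun m => by positivity)).mul_right M
  have hFc : ∀ x, Continuous (F x) := fun x => by
    have h1 := continuous_dotConj ζ
    have h2 := Complex.continuous_conj.comp h1
    exact continuous_const.mul (((h1.pow _).mul (h2.pow _)).mul (continuous_ev_sphere p))
  have hFB : ∀ x η, ‖F x η‖ ≤ B x := fun x η => by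
    have hw := norm_dotConj_le ζ η
    have hw1 : ‖dotConj ζ η‖ ^ x.1 ≤ 1 := pow_le_one₀ (norm_nonneg _) hw
    have hw2 : ‖dotConj ζ η‖ ^ x.2 ≤ 1 := pow_le_one₀ (norm_nonneg _) hw
    simp only [hF, hB, norm_mul, norm_pow, Complex.norm_conj, Complex.norm_real,
      Real.norm_of_nonneg h0]
    have e : ‖dotConj ζ η‖ ^ x.1 * ‖dotConj ζ η‖ ^ x.2 * ‖ev (η : EuclideanSpace ℂ (Fin (n + 1))) p‖ ≤ M :=
      (mul_le_of_le_one_left (norm_nonneg _) (mul_le_one₀ hw1 (by positivity) hw2)).trans (hM η)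
    calc _ ≤ ‖c α x.1‖ * ‖c β x.2‖ * r ^ (x.1 + x.2) * M := by gcongr
      _ = _ := by rw [pow_add]; ring
  have hpt : ∀ η, HasSum (fun x => F x η) (powKernel α β (r * dotConj ζ η) * ev η p) := by
    intro η
    have hw : ‖(r : ℂ) * dotConj ζ η‖ < 1 := by
      rw [norm_mul, Complex.norm_real, Real.norm_of_nonneg h0]
      nlinarith [norm_dotConj_le ζ η, norm_nonneg (dotConj ζ η)]
    have s3 := hasSum_powKernel α β hw
    have e : ∀ x, F x η = ((c α x.1 : ℝ) : ℂ) * (r * dotConj ζ η) ^ x.1 *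
        (((c β x.2 : ℝ) : ℂ) * conj (r * dotConj ζ η) ^ x.2) *
        ev (η : EuclideanSpace ℂ (Fin (n + 1))) p := fun x => by
      simp only [hF, map_mul, Complex.conj_ofReal]
      push_cast
      ring
    simp only [e]
    exact s3.mul_right _
  have key := hasSum_integral_of_dominated_convergence (μ := surface n) (fun x _ => B x)
    (fun x => (hFc x).aestronglyMeasurable)
    (fun x => Eventually.of_forall (hFB x)) (Eventually.of_forall fun _ => hBs)
    (integrable_const _) (Eventually.of_forall hpt)
  have hinj : Function.Injective fun m : ℕ => (j + m, k + m) := fun a b h => by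
    simpa using congrArg Prod.fst h
  have hint : ∀ x : ℕ × ℕ, ∫ η, F x η ∂(surface n) =
      (((c α x.1 * c β x.2) * r ^ (x.1 + x.2) : ℝ) : ℂ) *
        ∫ η : Sph n, dotConj ζ η ^ x.1 * conj (dotConj ζ η) ^ x.2 * ev η p ∂(surface n) :=
    fun x => integral_const_mul _ _
  rw [← hinj.hasSum_iff] at key
  · have e : ∀ m, ((r ^ (j + k + 2 * m) * eigenTerm n j k α β m : ℝ) : ℂ) *
        ev (ζ : EuclideanSpace ℂ (Fin (n + 1))) p =
        ∫ η, F (j + m, k + m) η ∂(surface n) := fun m => by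
      rw [hint, integral_dotConj_pow_mul_eq ζ hp m, ← mul_assoc, ← Complex.ofReal_mul]
      congr 2
      simp only [hc, eigenTerm]
      have h1 : ((j + m).factorial : ℝ) ≠ 0 := by positivity
      have h2 : ((k + m).factorial : ℝ) ≠ 0 := by positivity
      rw [show j + m + (k + m) = j + k + 2 * m by ring]
      field_simp
    simp only [e]
    exact key
  · rintro ⟨a, b⟩ hab
    rw [hint, integral_dotConj_pow_mul_eq_zero ζ hp, mul_zero]
    rintro ⟨m, rfl, rfl⟩
    exact hab ⟨m, rfl⟩

/-! ### Integrability and the limit r → 1. -/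

/-- A sequence in `[0, 1)` converging to `1`. -/
def radius (i : ℕ) : ℝ := i / (i + 1)

lemma radius_nonneg (i : ℕ) : 0 ≤ radius i := by unfold radius; positivity

lemma radius_lt_one (i : ℕ) : radius i < 1 := by
  unfold radius
  rw [div_lt_one (by positivity)]
  linarith

lemma tendsto_radius : Tendsto radius atTop (𝓝 1) := tendsto_natCast_div_add_atTop (1 : ℝ)

lemma tendsto_radius_mul (w : ℂ) : Tendsto (fun i => (radius i : ℂ) * w) atTop (𝓝 w) := by
  have h : Tendsto (fun i => (radius i : ℂ)) atTop (𝓝 ((1 : ℝ) : ℂ)) :=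
    (Complex.continuous_ofReal.tendsto 1).comp tendsto_radius
  simpa using h.mul_const w

lemma one_mem_harmonicPoly (n : ℕ) : (1 : BiPoly n) ∈ harmonicPoly n 0 0 := by
  rw [mem_harmonicPoly]
  refine ⟨MvPolynomial.isWeightedHomogeneous_one _ _, MvPolynomial.isWeightedHomogeneous_one _ _, ?_⟩
  simp [quarterLaplacian_apply]

lemma norm_radius_mul_dotConj_lt (ζ η : Sph n) (i : ℕ) : ‖(radius i : ℂ) * dotConj ζ η‖ < 1 := by
  rw [norm_mul, Complex.norm_real, Real.norm_of_nonneg (radius_nonneg i)]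
  nlinarith [norm_dotConj_le ζ η, norm_nonneg (dotConj ζ η), radius_nonneg i, radius_lt_one i]

lemma continuous_powKernel_radius (α β : ℝ) (ζ : Sph n) (i : ℕ) :
    Continuous fun η => powKernel α β (radius i * dotConj ζ η) := by
  refine continuous_iff_continuousAt.2 fun η => ?_
  have h := norm_radius_mul_dotConj_lt ζ η i
  have h1 : (radius i : ℂ) * dotConj ζ η ≠ 1 := fun h1 => by
    rw [h1, norm_one] at h; exact lt_irrefl _ h
  exact (continuousAt_powKernel α β h.le h1).comp
    (f := fun η => (radius i : ℂ) * dotConj ζ η)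
    (continuous_const.mul (continuous_dotConj ζ)).continuousAt

lemma eigenTerm_zero_nonneg {s : ℝ} (hs : 0 < s) (m : ℕ) : 0 ≤ eigenTerm n 0 0 s s m := by
  unfold eigenTerm
  have := poch_pos hs (0 + m)
  positivity

/-- A uniform bound for the mean of `|1 - r ζ·η̄|^{-s}` over the sphere as `r → 1`. -/
lemma integral_norm_one_sub_radius_le {s : ℝ} (hs : 0 < s) (hsn : s < n + 1) (ζ : Sph n) (i : ℕ) :
    ∫ η : Sph n, ‖1 - (radius i : ℂ) * dotConj ζ η‖ ^ (-s) ∂(surface n) ≤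
      eigen n 0 0 (s / 2) (s / 2) := by
  have h := hasSum_integral_powKernel_mul (s / 2) (s / 2) ζ (one_mem_harmonicPoly n)
    (radius_nonneg i) (radius_lt_one i)
  have e : ∀ η : Sph n, powKernel (s / 2) (s / 2) (radius i * dotConj ζ η) *
      ev (η : EuclideanSpace ℂ (Fin (n + 1))) 1 =
      ((‖1 - (radius i : ℂ) * dotConj ζ η‖ ^ (-s) : ℝ) : ℂ) := fun η => by
    rw [powKernel_self _ (norm_radius_mul_dotConj_lt ζ η i).le, map_one, mul_one]
    congr 2
    ring
  simp only [e] at h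
  rw [integral_complex_ofReal, map_one] at h
  simp only [mul_one] at h
  have h' := Complex.hasSum_ofReal.1 h
  -- With exponents s/2 > 0 all terms are nonnegative, so replacing the powers of r by 1 only
  -- increases the sum.
  refine hasSum_le (fun m => ?_) h' (hasSum_eigenTerm (n := n) 0 0 (α := s / 2) (β := s / 2)
    (by linarith) (by linarith) (by linarith))
  exact mul_le_of_le_one_left (eigenTerm_zero_nonneg (half_pos hs) m)
    (pow_le_one₀ (radius_nonneg i) (radius_lt_one i).le)

/-- For s > 0 no local analysis at the singularity is needed: Fatou's lemma transfers the uniform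
bound for r < 1 to r = 1. For s ≤ 0 the function is continuous. -/
lemma integrable_norm_one_sub_rpow {s : ℝ} (hsn : s < n + 1) (ζ : Sph n) :
    Integrable (fun η => ‖1 - dotConj ζ η‖ ^ (-s)) (surface n) := by
  have hcont : Continuous fun η => ‖1 - dotConj ζ η‖ :=
    (continuous_const.sub (continuous_dotConj ζ)).norm
  rcases le_or_gt s 0 with hs | hs
  · have hc : Continuous fun η => ‖1 - dotConj ζ η‖ ^ (-s) :=
      hcont.rpow_const fun η => Or.inr (by linarith)
    exact hc.integrable_of_hasCompactSupport (HasCompactSupport.of_compactSpace _)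
  · have hmeas : Measurable fun η => ‖1 - dotConj ζ η‖ ^ (-s) := hcont.measurable.pow_const _
    refine ⟨hmeas.aestronglyMeasurable, ?_⟩
    rw [hasFiniteIntegral_iff_ofReal (Eventually.of_forall fun η => by positivity)]
    have hc : ∀ i, Continuous fun η => ‖1 - (radius i : ℂ) * dotConj ζ η‖ ^ (-s) := fun i =>
      (continuous_const.sub (continuous_const.mul (continuous_dotConj ζ))).norm.rpow_const
        fun η => Or.inl <| norm_ne_zero_iff.2 <| sub_ne_zero.2 fun h => by
          have h1 : 1 = (radius i : ℂ) * dotConj ζ η := h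
          have := norm_radius_mul_dotConj_lt ζ η i
          rw [← h1, norm_one] at this
          exact lt_irrefl _ this
    have hle : ∀ i, ∫⁻ η, ENNReal.ofReal (‖1 - (radius i : ℂ) * dotConj ζ η‖ ^ (-s)) ∂(surface n) ≤
        ENNReal.ofReal (eigen n 0 0 (s / 2) (s / 2)) := fun i => by
      rw [← ofReal_integral_eq_lintegral_ofReal
        ((hc i).integrable_of_hasCompactSupport (HasCompactSupport.of_compactSpace _))
        (Eventually.of_forall fun η => by positivity)]
      exact ENNReal.ofReal_le_ofReal (integral_norm_one_sub_radius_le hs hsn ζ i)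
    calc ∫⁻ η, ENNReal.ofReal (‖1 - dotConj ζ η‖ ^ (-s)) ∂(surface n)
        = ∫⁻ η, liminf (fun i => ENNReal.ofReal
            (‖1 - (radius i : ℂ) * dotConj ζ η‖ ^ (-s))) atTop ∂(surface n) := by
          refine lintegral_congr_ae ?_
          filter_upwards [ae_dotConj_ne_one ζ] with η hη
          refine (Tendsto.liminf_eq ?_).symm
          refine ENNReal.tendsto_ofReal ?_
          refine Tendsto.rpow_const ?_ (Or.inl (norm_ne_zero_iff.2 (sub_ne_zero.2 hη.symm)))
          exact (tendsto_const_nhds.sub (tendsto_radius_mul _)).norm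
      _ ≤ liminf (fun i => ∫⁻ η, ENNReal.ofReal
            (‖1 - (radius i : ℂ) * dotConj ζ η‖ ^ (-s)) ∂(surface n)) atTop :=
          lintegral_liminf_le fun i => (hc i).measurable.ennreal_ofReal
      _ ≤ ENNReal.ofReal (eigen n 0 0 (s / 2) (s / 2)) :=
          liminf_le_of_le (by isBoundedDefault) fun b hb => by
            obtain ⟨i, hi⟩ := hb.exists
            exact hi.trans (hle i)
      _ < ⊤ := ENNReal.ofReal_lt_top

/-- The Funk–Hecke formula for the kernel `(1 - ζ·η̄)^{-α} (1 - η·ζ̄)^{-β}`. -/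
theorem integrable_and_integral_powKernel_mul {α β : ℝ} (hα : α < n + 1) (hβ : β < n + 1)
    (h : α + β < n + 1) (ζ : Sph n) {j k : ℕ} {p : BiPoly n} (hp : p ∈ harmonicPoly n j k) :
    Integrable (fun η : Sph n => powKernel α β (dotConj ζ η) * ev η p) (surface n) ∧
    ∫ η : Sph n, powKernel α β (dotConj ζ η) * ev η p ∂(surface n) =
      (eigen n j k α β : ℂ) * ev ζ p := by
  obtain ⟨M, hM⟩ := exists_norm_ev_sphere_le p
  have hI := integrable_norm_one_sub_rpow h ζ
  have hmeas : AEStronglyMeasurable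
      (fun η : Sph n => powKernel α β (dotConj ζ η) * ev η p) (surface n) :=
    (((measurable_powKernel α β).comp (continuous_dotConj ζ).measurable).mul
      (continuous_ev_sphere p).measurable).aestronglyMeasurable
  constructor
  · refine (hI.mul_const M).mono' hmeas ?_
    filter_upwards [ae_dotConj_ne_one ζ] with η hη
    rw [norm_mul, norm_powKernel α β hη]
    have := hM η
    gcongr
  -- The limit r → 1 is taken twice, in the integral and in the series, each by dominated
  -- convergence; the series is dominated by its own terms at r = 1.
  · have h1 : Tendsto (fun i => ∫ η : Sph n, powKernel α β (radius i * dotConj ζ η) *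
        ev η p ∂(surface n)) atTop
        (𝓝 (∫ η : Sph n, powKernel α β (dotConj ζ η) * ev η p ∂(surface n))) := by
      refine tendsto_integral_of_dominated_convergence
        (fun η => 2 ^ |α + β| * (‖1 - dotConj ζ η‖ ^ (-(α + β)) + 1) * M) ?_ ?_ ?_ ?_
      · exact fun i => ((continuous_powKernel_radius α β ζ i).mul
          (continuous_ev_sphere p)).aestronglyMeasurable
      · exact ((hI.add (integrable_const 1)).const_mul _).mul_const M
      · intro i
        filter_upwards [ae_dotConj_ne_one ζ] with η hη
        rw [norm_mul]
        exact mul_le_mul (norm_powKernel_mul_le α β (norm_dotConj_le ζ η) hη (radius_nonneg i)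
          (radius_lt_one i)) (hM η) (norm_nonneg _) (by positivity)
      · filter_upwards [ae_dotConj_ne_one ζ] with η hη
        exact ((continuousAt_powKernel α β (norm_dotConj_le ζ η) hη).tendsto.comp
          (tendsto_radius_mul _)).mul_const _
    have hs := hasSum_eigenTerm (n := n) j k hα hβ h
    have h2 : Tendsto (fun i => ∑' m, ((radius i ^ (j + k + 2 * m) * eigenTerm n j k α β m : ℝ)))
        atTop (𝓝 (eigen n j k α β)) := by
      rw [← hs.tsum_eq]
      refine tendsto_tsum_of_dominated_convergence hs.summable.norm (fun m => ?_)
        (Eventually.of_forall fun i m => ?_)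
      · simpa using (tendsto_radius.pow (j + k + 2 * m)).mul_const (eigenTerm n j k α β m)
      · rw [norm_mul, norm_pow, Real.norm_of_nonneg (radius_nonneg i)]
        exact mul_le_of_le_one_left (norm_nonneg _)
          (pow_le_one₀ (radius_nonneg i) (radius_lt_one i).le)
    have h3 := ((Complex.continuous_ofReal.tendsto _).comp h2).mul_const
      (ev (ζ : EuclideanSpace ℂ (Fin (n + 1))) p)
    refine tendsto_nhds_unique h1 (h3.congr fun i => ?_)
    have h4 := (hasSum_integral_powKernel_mul α β ζ hp (radius_nonneg i) (radius_lt_one i)).tsum_eq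
    rw [← h4, tsum_mul_right, Function.comp, Complex.ofReal_tsum]

/-! ### Eigenvalues of the two kernels. -/

lemma ne_zero_of_mem_Hjk (hn : 1 ≤ n) (j k : ℕ) : Hjk n j k ≠ ⊥ := by
  have h0l : (0 : Fin (n + 1)) ≠ Fin.last n := by
    intro h
    have := congrArg Fin.val h
    simp at this
    omega
  -- As n ≥ 1, the indices 0 and n differ, so no ∂ᵢ∂̄ᵢ sees both factors and the monomial is
  -- harmonic. It is nonzero at the unit vector with equal coordinates.
  set p : BiPoly n := MvPolynomial.X (Sum.inl 0) ^ j * MvPolynomial.X (Sum.inr (Fin.last n)) ^ k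
    with hp
  have hmem : p ∈ harmonicPoly n j k := by
    rw [mem_harmonicPoly]
    refine ⟨?_, ?_, ?_⟩
    · have h1 := (MvPolynomial.isWeightedHomogeneous_X ℂ (wz n) (Sum.inl 0)).pow j
      have h2 := (MvPolynomial.isWeightedHomogeneous_X ℂ (wz n) (Sum.inr (Fin.last n))).pow k
      simpa using h1.mul h2
    · have h1 := (MvPolynomial.isWeightedHomogeneous_X ℂ (wzbar n) (Sum.inl 0)).pow j
      have h2 := (MvPolynomial.isWeightedHomogeneous_X ℂ (wzbar n) (Sum.inr (Fin.last n))).pow k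
      simpa using h1.mul h2
    · rw [quarterLaplacian_apply]
      refine Finset.sum_eq_zero fun i _ => ?_
      by_cases hi : i = 0
      · have h1 : MvPolynomial.pderiv (Sum.inr i) p = 0 := by
          simp [hp, Derivation.leibniz, Derivation.leibniz_pow, MvPolynomial.pderiv_X,
            hi, h0l.symm]
        rw [h1, map_zero]
      · have h1 : MvPolynomial.pderiv (Sum.inl i) p = 0 := by
          simp [hp, Derivation.leibniz, Derivation.leibniz_pow, MvPolynomial.pderiv_X,
            Ne.symm hi]
        rw [pderiv_comm, h1, map_zero]
  intro hbot
  have hz : restrict n p = 0 := by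
    have : restrict n p ∈ Hjk n j k := Submodule.mem_map_of_mem hmem
    rwa [hbot, Submodule.mem_bot] at this
  set v : EuclideanSpace ℂ (Fin (n + 1)) := WithLp.toLp 2 fun _ => 1 with hv
  have hv0 : v ≠ 0 := fun h => by
    have := congrArg (fun x : EuclideanSpace ℂ (Fin (n + 1)) => x 0) h
    simp [hv] at this
  have hv1 : ((‖v‖⁻¹ : ℝ) : ℂ) ≠ 0 := by simpa using hv0
  set ζ : Sph n := ⟨(‖v‖⁻¹ : ℝ) • v, by simp [norm_smul, hv0]⟩ with hζ
  have hζi : ∀ i, (ζ : EuclideanSpace ℂ (Fin (n + 1))) i = ((‖v‖⁻¹ : ℝ) : ℂ) := fun i => by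
    change (‖v‖⁻¹ : ℝ) • (1 : ℂ) = _
    rw [Complex.real_smul, mul_one]
  have h1 : ev (ζ : EuclideanSpace ℂ (Fin (n + 1))) p = 0 := congrFun hz ζ
  rw [hp, map_mul, map_pow, map_pow, ev_X_inl, ev_X_inr, hζi, hζi, Complex.conj_ofReal] at h1
  exact mul_ne_zero (pow_ne_zero _ hv1) (pow_ne_zero _ hv1) h1

lemma actsAs_of_forall_powKernel {K : Sph n → Sph n → ℝ} {j k : ℕ} {c : ℝ} (hn : 1 ≤ n)
    (h : ∀ ζ : Sph n, ∀ p ∈ harmonicPoly n j k,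
      Integrable (fun η : Sph n => (K ζ η : ℂ) * ev η p) (surface n) ∧
      ∫ η : Sph n, (K ζ η : ℂ) * ev η p ∂(surface n) = (c : ℂ) * ev ζ p) :
    ActsAs K (Hjk n j k) c := by
  refine ⟨ne_zero_of_mem_Hjk hn j k, ?_⟩
  rintro _ ⟨p, hp, rfl⟩ ζ
  exact h ζ p hp

theorem actsAs_kernel₁ (hn : 1 ≤ n) {α : ℝ} (hα : α < ((n : ℝ) + 1) / 2) (j k : ℕ) :
    ActsAs (kernel₁ n α) (Hjk n j k) (eigen n j k α α) := by
  have hn' : (0 : ℝ) ≤ n := n.cast_nonneg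
  refine actsAs_of_forall_powKernel hn fun ζ p hp => ?_
  have h := integrable_and_integral_powKernel_mul (α := α) (β := α) (by linarith) (by linarith)
    (by linarith) ζ hp
  simp only [powKernel_self α (norm_dotConj_le ζ _)] at h
  exact h

/-- The eigenvalue of the second kernel, as a combination of eigenvalues of power kernels. -/
def eigen₂ (n j k : ℕ) (α : ℝ) : ℝ :=
  eigen n j k α α - eigen n j k (α - 1) α - eigen n j k α (α - 1) + eigen n j k (α - 1) (α - 1)

/-- Expand |w|² = (1 - (1 - w))(1 - (1 - w̄)); each factor 1 - w or 1 - w̄ lowers one exponent by 1,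
which requires w ≠ 1. -/
lemma kernel₂_eq {α : ℝ} {ζ η : Sph n} (h : dotConj ζ η ≠ 1) : (kernel₂ n α ζ η : ℂ) =
    powKernel α α (dotConj ζ η) - powKernel (α - 1) α (dotConj ζ η) -
      powKernel α (α - 1) (dotConj ζ η) + powKernel (α - 1) (α - 1) (dotConj ζ η) := by
  rw [powKernel_sub_one α (α - 1) h, powKernel_sub_one α α h, powKernel_sub_one_right α α h,
    powKernel_self α (norm_dotConj_le ζ η), kernel₂]
  have e : ((‖dotConj ζ η‖ ^ 2 : ℝ) : ℂ) = dotConj ζ η * conj (dotConj ζ η) := by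
    rw [Complex.mul_conj, Complex.normSq_eq_norm_sq]
  rw [Complex.ofReal_mul, e]
  ring

lemma integral_sub_sub_add {X : Type*} [MeasurableSpace X] {μ : Measure X} {f₁ f₂ f₃ f₄ : X → ℂ}
    (h₁ : Integrable f₁ μ) (h₂ : Integrable f₂ μ) (h₃ : Integrable f₃ μ) (h₄ : Integrable f₄ μ) :
    Integrable (fun x => f₁ x - f₂ x - f₃ x + f₄ x) μ ∧
    ∫ x, (f₁ x - f₂ x - f₃ x + f₄ x) ∂μ =
      ∫ x, f₁ x ∂μ - ∫ x, f₂ x ∂μ - ∫ x, f₃ x ∂μ + ∫ x, f₄ x ∂μ := by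
  have h₁₂ : Integrable (fun x => f₁ x - f₂ x) μ := h₁.sub h₂
  have h₁₂₃ : Integrable (fun x => f₁ x - f₂ x - f₃ x) μ := h₁₂.sub h₃
  exact ⟨h₁₂₃.add h₄, by rw [integral_add h₁₂₃ h₄, integral_sub h₁₂ h₃, integral_sub h₁ h₂]⟩

theorem actsAs_kernel₂ (hn : 1 ≤ n) {α : ℝ} (hα : α < ((n : ℝ) + 1) / 2) (j k : ℕ) :
    ActsAs (kernel₂ n α) (Hjk n j k) (eigen₂ n j k α) := by
  have hn' : (0 : ℝ) ≤ n := n.cast_nonneg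
  refine actsAs_of_forall_powKernel hn fun ζ p hp => ?_
  obtain ⟨i1, e1⟩ := integrable_and_integral_powKernel_mul (α := α) (β := α) (by linarith)
    (by linarith) (by linarith) ζ hp
  obtain ⟨i2, e2⟩ := integrable_and_integral_powKernel_mul (α := α - 1) (β := α) (by linarith)
    (by linarith) (by linarith) ζ hp
  obtain ⟨i3, e3⟩ := integrable_and_integral_powKernel_mul (α := α) (β := α - 1) (by linarith)
    (by linarith) (by linarith) ζ hp
  obtain ⟨i4, e4⟩ := integrable_and_integral_powKernel_mul (α := α - 1) (β := α - 1) (by linarith)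
    (by linarith) (by linarith) ζ hp
  have hae : (fun η : Sph n => (kernel₂ n α ζ η : ℂ) * ev η p) =ᵐ[surface n] fun η : Sph n =>
      powKernel α α (dotConj ζ η) * ev η p - powKernel (α - 1) α (dotConj ζ η) * ev η p -
      powKernel α (α - 1) (dotConj ζ η) * ev η p +
      powKernel (α - 1) (α - 1) (dotConj ζ η) * ev η p := by
    filter_upwards [ae_dotConj_ne_one ζ] with η hη
    rw [kernel₂_eq hη]; ring
  obtain ⟨hint, heq⟩ := integral_sub_sub_add i1 i2 i3 i4
  refine ⟨(integrable_congr hae).2 hint, ?_⟩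
  rw [integral_congr_ae hae, heq, e1, e2, e3, e4, eigen₂]
  push_cast
  ring

/-! ### Comparison with the closed forms and the limits at α = 0 and α = 1. -/

lemma continuousAt_eigen {n j k : ℕ} {f g : ℝ → ℝ} {α : ℝ} (hf : ContinuousAt f α)
    (hg : ContinuousAt g α) (h1 : f α < n + 1) (h2 : g α < n + 1) (h3 : f α + g α < n + 1) :
    ContinuousAt (fun x => eigen n j k (f x) (g x)) α := by
  have hG : ∀ {u : ℝ → ℝ}, ContinuousAt u α → 0 < u α →
      ContinuousAt (fun x => Real.Gamma (u x)) α := fun {u} hu h0 => by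
    refine ContinuousAt.comp (g := Real.Gamma) ?_ hu
    refine (Real.differentiableAt_Gamma fun m hm => ?_).continuousAt
    have : (0 : ℝ) ≤ m := m.cast_nonneg
    linarith
  have hj : (0 : ℝ) ≤ j := j.cast_nonneg
  have hk : (0 : ℝ) ≤ k := k.cast_nonneg
  have p1 : 0 < (j : ℝ) + n + 1 - g α := by linarith
  have p2 : 0 < (k : ℝ) + n + 1 - f α := by linarith
  unfold eigen
  refine ((continuousAt_const.mul (hG (by fun_prop) (by linarith))).mul
    (((continuous_poch j).continuousAt.comp hf).div (hG (by fun_prop) p1)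
      (Real.Gamma_pos_of_pos p1).ne')).mul
    (((continuous_poch k).continuousAt.comp hg).div (hG (by fun_prop) p2)
      (Real.Gamma_pos_of_pos p2).ne')

lemma continuousAt_eigen_self {j k : ℕ} {α : ℝ} (hα : α < ((n : ℝ) + 1) / 2) :
    ContinuousAt (fun x => eigen n j k x x) α := by
  have hn' : (0 : ℝ) ≤ n := n.cast_nonneg
  have hi : ContinuousAt (fun x : ℝ => x) α := by fun_prop
  exact continuousAt_eigen hi hi (by linarith) (by linarith) (by linarith)

lemma continuousAt_eigen₂ {j k : ℕ} {α : ℝ} (hα : α < ((n : ℝ) + 1) / 2) :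
    ContinuousAt (eigen₂ n j k) α := by
  have hn' : (0 : ℝ) ≤ n := n.cast_nonneg
  have hs : ContinuousAt (fun x : ℝ => x - 1) α := by fun_prop
  have hi : ContinuousAt (fun x : ℝ => x) α := by fun_prop
  unfold eigen₂
  exact (((continuousAt_eigen hi hi (by linarith) (by linarith) (by linarith)).sub
    (continuousAt_eigen hs hi (by linarith) (by linarith) (by linarith))).sub
    (continuousAt_eigen hi hs (by linarith) (by linarith) (by linarith))).add
    (continuousAt_eigen hs hs (by linarith) (by linarith) (by linarith))

lemma ne_neg_natCast {α : ℝ} (h : -1 < α) (h0 : α ≠ 0) (m : ℕ) : α ≠ -m := by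
  rcases m with _ | m
  · simpa using h0
  · push_cast
    intro hm
    linarith [(m.cast_nonneg : (0 : ℝ) ≤ m)]

/-- Γ(j + α) = Γ(α) (α)_j cancels the Γ(α)² in the denominator; 0 is the only pole of Γ in (-1, ∞).
-/
lemma E_eq_eigen {α : ℝ} (h : -1 < α) (h0 : α ≠ 0) (j k : ℕ) :
    E n j k α = eigen n j k α α := by
  have hα := ne_neg_natCast h h0
  have hΓ := Real.Gamma_ne_zero hα
  rw [E, eigen, add_comm (j : ℝ) α, add_comm (k : ℝ) α, ← Gamma_mul_poch hα, ← Gamma_mul_poch hα,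
    show (n : ℝ) + 1 - α - α = n + 1 - 2 * α by ring]
  field_simp

/-- All four eigenvalues are rational multiples of one another, by (α - 1)_m = (α)_m (α - 1)/(m - 1
+ α) and Γ(x + 1) = x Γ(x), so the claim becomes a rational identity. -/
lemma E'_eq_eigen₂ {α : ℝ} (h : -1 < α) (hα : α < ((n : ℝ) + 1) / 2) (h0 : α ≠ 0) (h1 : α ≠ 1)
    (j k : ℕ) : E' n j k α = eigen₂ n j k α := by
  have hn' : (0 : ℝ) ≤ n := n.cast_nonneg
  -- This denominator vanishes for m = 0 at α = 1 and for m = 1 at α = 0, the two excluded values.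
  have hp : ∀ m : ℕ, (m : ℝ) - 1 + α ≠ 0 := by
    intro m
    rcases m with _ | _ | m
    · simp only [Nat.cast_zero]; intro h2; exact h1 (by linarith)
    · simp only [zero_add, Nat.cast_one]; intro h2; exact h0 (by linarith)
    · have hm : (0 : ℝ) ≤ m := m.cast_nonneg
      have h2 : 0 < (m : ℝ) + 1 + 1 - 1 + α := by linarith
      push_cast
      exact h2.ne'
  have hq : ∀ m : ℕ, 0 < (m : ℝ) + n + 1 - α := fun m => by
    linarith [(m.cast_nonneg : (0 : ℝ) ≤ m)]
  have hpoch : ∀ m : ℕ, poch (α - 1) m = poch α m * (α - 1) / (m - 1 + α) := fun m => by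
    rw [eq_div_iff (hp m)]
    have := poch_add_one_left_mul (α - 1) m
    rw [sub_add_cancel] at this
    rw [this]; ring
  have hΓ : ∀ m : ℕ, Real.Gamma (m + n + 1 - (α - 1)) =
      (m + n + 1 - α) * Real.Gamma (m + n + 1 - α) := fun m => by
    rw [← Real.Gamma_add_one (hq m).ne']; ring_nf
  have hg : (n : ℝ) + 1 - 2 * α ≠ 0 := by linarith
  have hg2 : (n : ℝ) + 2 - 2 * α ≠ 0 := by linarith
  have e1 : Real.Gamma (n + 1 - (α - 1) - α) = (n + 1 - 2 * α) * Real.Gamma (n + 1 - 2 * α) := by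
    rw [← Real.Gamma_add_one hg]; ring_nf
  have e2 : Real.Gamma (n + 1 - α - (α - 1)) = (n + 1 - 2 * α) * Real.Gamma (n + 1 - 2 * α) := by
    rw [← Real.Gamma_add_one hg]; ring_nf
  have e3 : Real.Gamma (n + 1 - (α - 1) - (α - 1)) =
      (n + 2 - 2 * α) * ((n + 1 - 2 * α) * Real.Gamma (n + 1 - 2 * α)) := by
    rw [← Real.Gamma_add_one hg, show (n : ℝ) + 1 - 2 * α + 1 = n + 2 - 2 * α by ring,
      ← Real.Gamma_add_one hg2]
    ring_nf
  rw [E', E_eq_eigen h h0, eigen₂]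
  simp only [eigen, e1, e2, e3, hΓ, hpoch,
    show (n : ℝ) + 1 - α - α = n + 1 - 2 * α by ring]
  have g1 := (Real.Gamma_pos_of_pos (hq j)).ne'
  have g2 := (Real.Gamma_pos_of_pos (hq k)).ne'
  have q1 := (hq j).ne'
  have q2 := (hq k).ne'
  have p1 := hp j
  have p2 := hp k
  field_simp
  ring

lemma tendsto_of_eq_off {f g : ℝ → ℝ} {N α : ℝ} (h : -1 < α) (hα : α < N)
    (hfg : ∀ x, -1 < x → x < N → x ≠ 0 → x ≠ 1 → f x = g x) (hg : ContinuousAt g α) :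
    Tendsto f (𝓝[≠] α) (𝓝 (g α)) := by
  have hne : ∀ b : ℝ, ∀ᶠ x in 𝓝[≠] α, x ≠ b := fun b => by
    rcases eq_or_ne α b with rfl | hb
    · exact self_mem_nhdsWithin
    · exact eventually_ne_nhdsWithin hb
  refine (hg.tendsto.mono_left nhdsWithin_le_nhds).congr' ?_
  filter_upwards [hne 0, hne 1, nhdsWithin_le_nhds (Ioo_mem_nhds h hα)] with x h0 h1 hx
  exact (hfg x hx.1 hx.2 h0 h1).symm

end ComplexSphere

end

theorem corollary4p3 (n : ℕ) (hn : 1 ≤ n) (α : ℝ) (hα₁ : -1 < α) (hα₂ : α < ((n : ℝ) + 1) / 2)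
    (j k : ℕ) :
    ((α ≠ 0 ∧ α ≠ 1 →
        ComplexSphere.ActsAs (ComplexSphere.kernel₁ n α) (ComplexSphere.Hjk n j k)
          (ComplexSphere.E n j k α)) ∧
      (α = 0 ∨ α = 1 → ∃ c : ℝ, Tendsto (ComplexSphere.E n j k) (𝓝[≠] α) (𝓝 c) ∧
        ComplexSphere.ActsAs (ComplexSphere.kernel₁ n α) (ComplexSphere.Hjk n j k) c)) ∧
    ((α ≠ 0 ∧ α ≠ 1 →
        ComplexSphere.ActsAs (ComplexSphere.kernel₂ n α) (ComplexSphere.Hjk n j k)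
          (ComplexSphere.E' n j k α)) ∧
      (α = 0 ∨ α = 1 → ∃ c : ℝ, Tendsto (ComplexSphere.E' n j k) (𝓝[≠] α) (𝓝 c) ∧
        ComplexSphere.ActsAs (ComplexSphere.kernel₂ n α) (ComplexSphere.Hjk n j k) c)) := by
  have k₁ := ComplexSphere.actsAs_kernel₁ hn hα₂ j k
  have k₂ := ComplexSphere.actsAs_kernel₂ hn hα₂ j k
  -- The limits are the eigenvalues `eigen` and `eigen₂` at α itself, read off from `k₁` and `k₂`,
  -- which hold at 0 and 1 as well.
  refine ⟨⟨fun h => ?_, fun _ => ⟨_, ?_, k₁⟩⟩, ⟨fun h => ?_, fun _ => ⟨_, ?_, k₂⟩⟩⟩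
  · rwa [ComplexSphere.E_eq_eigen hα₁ h.1]
  · exact ComplexSphere.tendsto_of_eq_off (g := fun x => ComplexSphere.eigen n j k x x) hα₁ hα₂
      (fun x hx _ h0 _ => ComplexSphere.E_eq_eigen hx h0 j k)
      (ComplexSphere.continuousAt_eigen_self hα₂)
  · rwa [ComplexSphere.E'_eq_eigen₂ hα₁ hα₂ h.1 h.2]
  · exact ComplexSphere.tendsto_of_eq_off hα₁ hα₂
      (fun x hx hx2 h0 h1 => ComplexSphere.E'_eq_eigen₂ hx hx2 h0 h1 j k)
      (ComplexSphere.continuousAt_eigen₂ hα₂)
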